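/- Let $H$ be a real separable Hilbert space with inner product $\langle\cdot,\cdot\rangle$ and norm $\|\cdot\|$, and let $A_i:D(A_i)\subset H\to H$, $i=1,\dots,n$, be (possibly unbounded) self-adjoint operators that are strictly positive, i.e. for each $i$ there is $\Lambda_i>0$ with $\langle A_ix,x\rangle\ge\Lambda_i\|x\|^2$ for all $x\in D(A_i)$. Put $D=\bigcap_{i=1}^nD(A_i)$ and $\|x\|_D=\sum_{i=1}^n\|A_ix\|$ for $x\in D$. Assume that the operators commute on $D$ in the sense that $\langle A_ix,A_jy\rangle=\langle A_jx,A_iy\rangle$ for all $x,y\in D$ and all $i,j$, and that for every $\boldsymbol\lambda\in\mathbb R_+^n=(0,\infty)^n$ the operator $A(\boldsymbol\lambda)=\lambda_1A_1+\dots+\lambda_nA_n$ with domain $D$ is self-adjoint. Let $\{e^{-tA(\boldsymbol\lambda)}\}_{t\ge0}$ be the strongly continuous semigroup on $H$ generated by $-A(\boldsymbol\lambda)$. For $0<\alpha<1$ let $$\Phi_\alpha(z)=\sum_{k=0}^\infty\frac{(-z)^k}{k!\,\Gamma(-\alpha k+1-\alpha)}$$ (with $1/\Gamma=0$ at the poles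 of $\Gamma$). Fix $\bar T>0$ and $u_0\in D$, and define $\boldsymbol{\mathcal F}_\alpha=(\mathcal F_{\alpha,1},\dots,\mathcal F_{\alpha,n})$ on $\mathbb R_+^n$ by $$\mathcal F_{\alpha,i}(\boldsymbol\lambda)=\int_0^\infty\!\!\int_0^\infty\Phi_\alpha(\tau)\Phi_\alpha(\sigma)\left\langle A_ie^{-\frac{\tau+\sigma}2\bar T^\alpha A(\boldsymbol\lambda)}u_0,\;e^{-\frac{\tau+\sigma}2\bar T^\alpha A(\boldsymbol\lambda)}u_0\right\rangle d\tau\,d\sigma\qquad(0<\alpha<1),$$ $$\mathcal F_{1,i}(\boldsymbol\lambda)=\left\langle A_ie^{-\bar TA(\boldsymbol\lambda)}u_0,\;e^{-\bar TA(\boldsymbol\lambda)}u_0\right\rangle .$$ Suppose that $u_0$ is admissible, i.e. that $A_1u_0,\dots,A_nu_0$ are linearly independent in $H$. Then for every $\alpha\in(0,1]$ the image $\mathrm{Im}\,\boldsymbol{\mathcal F}_\alpha=\boldsymbol{\mathcal F}_\alpha(\mathbb R_+^n)$ is contained in $\mathbb R_+^n$, it is open in $\mathbb R^n$ and path-connected,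 and $$|\boldsymbol{\mathcal F}_\alpha(\boldsymbol\lambda)|\le\|u_0\|_D\,\|u_0\|\qquad\text{for all }\boldsymbol\lambda\in\mathbb R_+^n\text{ and all }\alpha\in(0,1],$$ where $|\cdot|$ is the Euclidean norm of $\mathbb R^n$. -/

import Mathlib

open Set Filter Topology MeasureTheory

namespace FractionalInverse

noncomputable section

variable {H : Type*} [NormedAddCommGroup H] [InnerProductSpace ℝ H]

/-! ### Strongly continuous semigroups and their generators -/

/-- `S` restricted to `[0, ∞)` is a strongly continuous semigroup of bounded operators on `H`. -/
structure IsC0Semigroup (S : ℝ → H →L[ℝ] H) : Prop where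
  map_zero : S 0 = ContinuousLinearMap.id ℝ H
  map_add : ∀ s t : ℝ, 0 ≤ s → 0 ≤ t → S (s + t) = (S s).comp (S t)
  continuousOn : ∀ x : H, ContinuousOn (fun t => S t x) (Ici 0)

/-- The (possibly unbounded) operator `B` is the infinitesimal generator of `S`: the domain of `B`
is the set of those `x` for which `(S h x - x) / h` converges as `h → 0⁺`, and `B x` is the limit. -/
def HasGenerator (S : ℝ → H →L[ℝ] H) (B : H →ₗ.[ℝ] H) : Prop :=
  ∀ x y : H, (x, y) ∈ B.graph ↔ Tendsto (fun h : ℝ => h⁻¹ • (S h x - x)) (𝓝[>] 0) (𝓝 y)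

open scoped Classical in
/-- The strongly continuous semigroup generated by `B` (a strongly continuous semigroup is
determined on `[0, ∞)` by its generator); `0` if `B` generates no such semigroup. -/
def semigroup (B : H →ₗ.[ℝ] H) : ℝ → H →L[ℝ] H :=
  if h : ∃ S : ℝ → H →L[ℝ] H, IsC0Semigroup S ∧ HasGenerator S B then h.choose else 0

/-- `expNeg A t` is the operator `e^{-tA}`, for `t ≥ 0`. -/
def expNeg (A : H →ₗ.[ℝ] H) (t : ℝ) : H →L[ℝ] H := semigroup (-A) t

/-! ### The family of operators -/

/-- Strict positivity (coercivity): `⟨A x, x⟩ ≥ Λ ‖x‖²` on `D(A)` for some `Λ > 0`. -/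
def StrictlyPositive (A : H →ₗ.[ℝ] H) : Prop :=
  ∃ Λ : ℝ, 0 < Λ ∧ ∀ x : A.domain, Λ * ‖(x : H)‖ ^ 2 ≤ inner ℝ (A x) (x : H)

open scoped Classical in
/-- The vector `A x` for `x ∈ D(A)`; the value `0` is used outside `D(A)`. -/
def app (A : H →ₗ.[ℝ] H) (x : H) : H := if hx : x ∈ A.domain then A ⟨x, hx⟩ else 0

variable {n : ℕ}

/-- The common domain `D = ⋂ i, D(A i)`. -/
def commonDomain (A : Fin n → H →ₗ.[ℝ] H) : Submodule ℝ H := ⨅ i, (A i).domain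

/-- The restriction of `A i` to `D`. -/
def onCommon (A : Fin n → H →ₗ.[ℝ] H) (i : Fin n) : commonDomain A →ₗ[ℝ] H :=
  (A i).toFun.comp (Submodule.inclusion (iInf_le (fun j => (A j).domain) i))

/-- Mutual commutation on `D`: `⟨A i x, A j y⟩ = ⟨A j x, A i y⟩` for all `x, y ∈ D`. -/
def CommuteOnCommon (A : Fin n → H →ₗ.[ℝ] H) : Prop :=
  ∀ (i j : Fin n) (x y : commonDomain A),
    inner ℝ (onCommon A i x) (onCommon A j y) = inner ℝ (onCommon A j x) (onCommon A i y)

/-- The operator `A(l) = l 1 A 1 + ⋯ + l n A n`, with domain `D`. -/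
def combination (A : Fin n → H →ₗ.[ℝ] H) (l : EuclideanSpace ℝ (Fin n)) : H →ₗ.[ℝ] H where
  domain := commonDomain A
  toFun := ∑ i, l i • onCommon A i

/-- The norm `‖x‖_D = ∑ i, ‖A i x‖` of `x ∈ D`. -/
def normD (A : Fin n → H →ₗ.[ℝ] H) (x : commonDomain A) : ℝ := ∑ i, ‖onCommon A i x‖

/-- `u₀ ∈ D` is admissible if the vectors `A 1 u₀, …, A n u₀` are linearly independent. -/
def Admissible (A : Fin n → H →ₗ.[ℝ] H) (u₀ : commonDomain A) : Prop :=
  LinearIndependent ℝ (fun i => onCommon A i u₀)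

/-! ### The map `F_α` -/

/-- The Wright type function `Φ_α(z) = ∑ k, (-z)^k / (k! Γ(-α k + 1 - α))`, `0 < α < 1`.
At the poles of `Γ` Mathlib has `Real.Gamma = 0`, so there the term is `0`, as it should be. -/
def wright (α z : ℝ) : ℝ :=
  ∑' k : ℕ, (-z) ^ k / ((k.factorial : ℝ) * Real.Gamma (-α * k + 1 - α))

/-- The energy `⟨A i e^{-t A(l)} u, e^{-t A(l)} u⟩`. -/
def energy (A : Fin n → H →ₗ.[ℝ] H) (u : H) (i : Fin n) (l : EuclideanSpace ℝ (Fin n))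
    (t : ℝ) : ℝ :=
  inner ℝ (app (A i) (expNeg (combination A l) t u)) (expNeg (combination A l) t u)

open scoped Classical in
/-- The map `F_α` with measuring time `T`. For `0 < α < 1` its components are
`∫∫ Φ_α(τ) Φ_α(σ) ⟨A i e^{-((τ+σ)/2) T^α A(l)} u₀, e^{-((τ+σ)/2) T^α A(l)} u₀⟩ dτ dσ`.
For `α = 1` they are `⟨A i e^{-T A(l)} u₀, e^{-T A(l)} u₀⟩`. -/
def forwardMap (A : Fin n → H →ₗ.[ℝ] H) (u₀ : H) (T α : ℝ) (l : EuclideanSpace ℝ (Fin n)) :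
    EuclideanSpace ℝ (Fin n) :=
  WithLp.toLp 2 fun i =>
    if α = 1 then energy A u₀ i l T
    else ∫ τ in Ioi (0 : ℝ), ∫ σ in Ioi (0 : ℝ),
      wright α τ * wright α σ * energy A u₀ i l ((τ + σ) / 2 * T ^ α)

/-- The open positive orthant `(0, ∞)^n`. -/
def posOrthant (n : ℕ) : Set (EuclideanSpace ℝ (Fin n)) := {l | ∀ i, 0 < l i}

/-- The image `Im F_α` of the map `F_α : (0, ∞)^n → ℝ^n`. -/
def imForward (A : Fin n → H →ₗ.[ℝ] H) (u₀ : H) (T α : ℝ) : Set (EuclideanSpace ℝ (Fin n)) :=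
  forwardMap A u₀ T α '' posOrthant n

end

end FractionalInverse

namespace FractionalInverse

/-! ### The Wright function -/

/-! Write S l t for e^{-tA(l)} and u for the initial value. Each `A i` commutes with S l t on D and
S l t is symmetric, so the energy at time t is ⟨A i u, S l (2t) u⟩ (`energy_eq`). Hence F_α is an
average of these quantities against a measure ρ on the half line (`exists_measure`): the Dirac mass
at T if α = 1, and otherwise the image of Φ_α(τ)Φ_α(σ) dτ dσ under (τ, σ) ↦ (τ + σ)/2 · T^α. The
only facts used about ρ are that it is nonzero, has mass at most 1 and lives on t > 0. The norm
bound is then Cauchy–Schwarz and contractivity; positivity is coercivity of `A i` and injectivity of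
S l t; path-connectedness is continuity on a convex set.

Openness holds because -F_α is the gradient field of the convex function l ↦ ∫ (⟨u, S l (2t) u⟩ -
‖u‖²)/(2t) dρ(t). Duhamel's formula writes differences of semigroups through S l (t - r) S m r A(m -
l), and S l (t - r) S m r is the square of a symmetric injective operator. This yields the
subgradient inequality and, since admissibility gives A(δ)u ≠ 0 for δ ≠ 0, strict monotonicity. A
continuous, strictly monotone gradient field has open image (`isOpen_image_of_strictMono_gradient`):
a value y close to G x₀ is attained at the minimum of φ - ⟨y, ·⟩ on a small ball, which is forced
into the interior.

For α < 1 the remaining point is that Φ_α is nonnegative with integral at most 1. By Gauss's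
product, Φ_α is a limit of rescaled coefficients of x^m in (1 - x)^{α-1} exp(-y(1 - x)^α); these are
e^{-y} times polynomials in y with nonnegative coefficients, that is, mixtures of Gamma densities
(`tendsto_wrightApprox`, `mixCoeff_nonneg`, `lintegral_wright_le_one`). -/

/-- The coefficient `∏_{j=1}^m (1 - β / j)` of `x ^ m` in the binomial series of `(1 - x)^(β - 1)`. -/
noncomputable def binomCoeff (m : ℕ) (β : ℝ) : ℝ := ∏ j ∈ Finset.range m, (1 - β / (j + 1))

lemma binomCoeff_succ (m : ℕ) (β : ℝ) :
    binomCoeff (m + 1) β = binomCoeff m β * (1 - β / (m + 1)) := by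
  simp [binomCoeff, Finset.prod_range_succ]

lemma abs_binomCoeff_le_of_le {m : ℕ} {β : ℝ} (h : (m : ℝ) ≤ β) :
    |binomCoeff m β| ≤ β ^ m / m.factorial := by
  induction m with
  | zero => simp [binomCoeff]
  | succ m ih =>
    push_cast at h
    have hm : (0 : ℝ) < m + 1 := by positivity
    rw [binomCoeff_succ, abs_mul, Nat.factorial_succ, pow_succ]
    have h1 : |1 - β / ((m : ℝ) + 1)| ≤ β / (m + 1) := by
      have : 1 ≤ β / ((m : ℝ) + 1) := by rw [le_div_iff₀ hm]; linarith
      rw [abs_le]; constructor <;> linarith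
    calc _ ≤ β ^ m / m.factorial * (β / (m + 1)) := by
            gcongr
            · exact (abs_nonneg _).trans (ih (by linarith))
            · exact ih (by linarith)
      _ = _ := by push_cast; field_simp

lemma one_sub_div_le_rpow {β : ℝ} (hβ : 0 ≤ β) {j : ℝ} (hj : 0 < j) :
    1 - β / j ≤ (j / (j + 1)) ^ β := by
  have h0 : 0 < j / (j + 1) := by positivity
  rw [Real.rpow_def_of_pos h0]
  have h1 : Real.log (j / (j + 1)) = - Real.log (1 + 1 / j) := by
    rw [← Real.log_inv]; congr 1; field_simp
  have h2 : Real.log (1 + 1 / j) ≤ 1 / j := by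
    have := Real.log_le_sub_one_of_pos (show 0 < 1 + 1 / j by positivity)
    linarith
  have h3 : -(β / j) ≤ Real.log (j / (j + 1)) * β := by
    rw [h1]
    have : Real.log (1 + 1 / j) * β ≤ 1 / j * β := by gcongr
    have e : β / j = 1 / j * β := by ring
    linarith
  have := Real.add_one_le_exp (Real.log (j / (j + 1)) * β)
  linarith

/-- Two regimes: as long as m ≤ β the product is at most β^m / m! ≤ e^β, and beyond that each new
factor 1 - β/j ≤ (j/(j+1))^β makes the left side decrease in m. -/
lemma abs_binomCoeff_mul_rpow_le {β : ℝ} (hβ : 0 ≤ β) (m : ℕ) :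
    |binomCoeff m β| * ((m : ℝ) + 1) ^ β ≤ Real.exp β * (β + 1) ^ β := by
  induction m with
  | zero =>
    simp only [binomCoeff, Finset.range_zero, Finset.prod_empty, abs_one, CharP.cast_eq_zero,
      zero_add, Real.one_rpow, mul_one]
    exact one_le_mul_of_one_le_of_one_le (Real.one_le_exp hβ)
      (Real.one_le_rpow (by linarith) hβ)
  | succ m ih =>
    rcases le_or_gt ((m + 1 : ℕ) : ℝ) β with h | h
    · gcongr
      exact (abs_binomCoeff_le_of_le h).trans (Real.pow_div_factorial_le_exp β hβ _)
    · refine le_trans ?_ ih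
      have hm : (0 : ℝ) < m + 1 := by positivity
      push_cast at h ⊢
      have h1 : 0 ≤ 1 - β / ((m : ℝ) + 1) := by
        have : β / ((m : ℝ) + 1) ≤ 1 := by rw [div_le_one hm]; linarith
        linarith
      rw [binomCoeff_succ, abs_mul, abs_of_nonneg h1, mul_assoc]
      gcongr
      calc _ ≤ (((m : ℝ) + 1) / (m + 1 + 1)) ^ β * ((m : ℝ) + 1 + 1) ^ β := by
            gcongr
            exact one_sub_div_le_rpow hβ hm
        _ = _ := by
            rw [← Real.mul_rpow (by positivity) (by positivity)]
            congr 1; field_simp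

/-- The products `(m + 1) m^(β - 1) ∏_{j=1}^{m+1} (1 - β / j)`, which tend to `1 / Γ(1 - β)`. -/
noncomputable def invGammaApprox (m : ℕ) (β : ℝ) : ℝ :=
  ((m : ℝ) + 1) * (m : ℝ) ^ (β - 1) * binomCoeff (m + 1) β

lemma invGammaApprox_eq {m : ℕ} (hm : m ≠ 0) (β : ℝ) :
    invGammaApprox m β = (Real.GammaSeq (1 - β) m)⁻¹ := by
  have hm0 : (0 : ℝ) < m := by positivity
  have h : ∏ j ∈ Finset.range (m + 1), (1 - β + j) = (m + 1).factorial * binomCoeff (m + 1) β := by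
    rw [binomCoeff, ← Finset.prod_range_add_one_eq_factorial, Nat.cast_prod,
      ← Finset.prod_mul_distrib]
    refine Finset.prod_congr rfl fun j _ => ?_
    have : (0 : ℝ) < j + 1 := by positivity
    push_cast
    field_simp
    ring
  rw [Real.GammaSeq, h, invGammaApprox, inv_div, Nat.factorial_succ, ← neg_sub β 1,
    Real.rpow_neg hm0.le]
  have h2 : (0 : ℝ) < m.factorial := by positivity
  have h3 : (0 : ℝ) < (m : ℝ) ^ (β - 1) := by positivity
  push_cast
  field_simp

lemma tendsto_invGammaApprox (β : ℝ) :
    Tendsto (fun m => invGammaApprox m β) atTop (𝓝 (Real.Gamma (1 - β))⁻¹) := by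
  -- The value 0 marks a pole, β = p + 1. Then the factor of index p vanishes, so the approximations
  -- are 0 from m = p on, in agreement with the convention 1/Γ = 0.
  by_cases h : Real.Gamma (1 - β) = 0
  · rw [h, inv_zero]
    rw [Real.Gamma_eq_zero_iff] at h
    obtain ⟨p, hp⟩ := h
    refine tendsto_const_nhds.congr' ?_
    filter_upwards [eventually_ge_atTop p] with m hm
    have : binomCoeff (m + 1) β = 0 := by
      refine Finset.prod_eq_zero (Finset.mem_range.2 (Nat.lt_succ_of_le hm)) ?_
      rw [show β = p + 1 by linarith, div_self (by positivity), sub_self]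
    simp [invGammaApprox, this]
  · refine ((Real.GammaSeq_tendsto_Gamma (1 - β)).inv₀ h).congr' ?_
    filter_upwards [eventually_ne_atTop 0] with m hm
    rw [invGammaApprox_eq hm]

lemma abs_invGammaApprox_le {β : ℝ} (hβ : 0 ≤ β) {m : ℕ} (hm : m ≠ 0) :
    |invGammaApprox m β| ≤ 2 * (Real.exp β * (β + 1) ^ β) := by
  have hm0 : (1 : ℝ) ≤ m := by exact_mod_cast Nat.one_le_iff_ne_zero.2 hm
  have hm1 : (0 : ℝ) < m := by linarith
  have e : |invGammaApprox m β|
      = ((m : ℝ) + 1) / m * (|binomCoeff (m + 1) β| * (m : ℝ) ^ β) := by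
    rw [invGammaApprox, abs_mul, abs_mul, abs_of_pos (by positivity : (0 : ℝ) < m + 1),
      abs_of_pos (by positivity), Real.rpow_sub_one hm1.ne']
    field_simp
  rw [e]
  have h1 : ((m : ℝ) + 1) / m ≤ 2 := by rw [div_le_iff₀ hm1]; linarith
  have h2 := abs_binomCoeff_mul_rpow_le hβ (m + 1)
  have h3 : (m : ℝ) ^ β ≤ (((m + 1 : ℕ) : ℝ) + 1) ^ β := by gcongr; push_cast; linarith
  exact mul_le_mul h1 ((mul_le_mul_of_nonneg_left h3 (abs_nonneg _)).trans h2) (by positivity)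
    (by norm_num)

/-- A bound, uniform in `m`, for the terms of the approximations of the Wright series. -/
noncomputable def wrightBound (α : ℝ) (k : ℕ) : ℝ :=
  2 * (Real.exp (α * (k + 1)) * (α * (k + 1) + 1) ^ (α * (k + 1)))

/-- Up to geometric factors the terms are ((k+1)!)^α / k!, whose ratios behave like k^{-(1-α)} and
tend to 0 because α < 1. -/
lemma summable_wrightBound {α : ℝ} (hα : 0 < α) (hα1 : α < 1) {z : ℝ} (hz : 0 < z) :
    Summable fun k : ℕ => z ^ k / (k.factorial : ℝ) * wrightBound α k := by
  set C : ℝ := z * (Real.exp α * Real.exp α) with hC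
  have hC0 : 0 < C := by positivity
  set T : ℕ → ℝ := fun k => C ^ k * ((k + 1).factorial : ℝ) ^ α / (k.factorial : ℝ) with hT
  have hTpos : ∀ k, 0 < T k := fun k => by positivity
  have hsum : Summable T := by
    refine summable_of_ratio_test_tendsto_lt_one (l := 0) one_pos
      (Eventually.of_forall fun k => (hTpos k).ne') ?_
    have hr : ∀ k : ℕ, ‖T (k + 1)‖ / ‖T k‖
        = C * (((k : ℝ) + 2) / (k + 1) * ((k : ℝ) + 2) ^ (-(1 - α))) := by
      intro k
      rw [Real.norm_of_nonneg (hTpos _).le, Real.norm_of_nonneg (hTpos _).le]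
      have h2 : (0 : ℝ) < (k : ℝ) + 2 := by positivity
      have hf : (0 : ℝ) < (k + 1).factorial := by positivity
      have e1 : (((k + 1 + 1).factorial : ℕ) : ℝ) ^ α
          = ((k : ℝ) + 2) ^ α * ((k + 1).factorial : ℝ) ^ α := by
        rw [Nat.factorial_succ, Nat.cast_mul, Real.mul_rpow (by positivity) (by positivity)]
        push_cast; ring_nf
      have e2 : ((k : ℝ) + 2) ^ (-(1 - α)) = ((k : ℝ) + 2) ^ α / ((k : ℝ) + 2) := by
        rw [neg_sub, Real.rpow_sub_one h2.ne']
      have e3 : ((k + 1).factorial : ℝ) = ((k : ℝ) + 1) * k.factorial := by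
        rw [Nat.factorial_succ]; push_cast; ring
      have hq : (0 : ℝ) < ((k + 1).factorial : ℝ) ^ α := by positivity
      have hk1 : (0 : ℝ) < k.factorial := by positivity
      simp only [hT]
      rw [e1, e2]
      generalize ((k + 1).factorial : ℝ) ^ α = q at *
      rw [e3, pow_succ]
      field_simp
    simp_rw [hr]
    have t1 : Tendsto (fun k : ℕ => ((k : ℝ) + 2) / (k + 1)) atTop (𝓝 1) := by
      have : Tendsto (fun k : ℕ => 1 + 1 / ((k : ℝ) + 1)) atTop (𝓝 (1 + 0)) :=
        tendsto_const_nhds.add tendsto_one_div_add_atTop_nhds_zero_nat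
      rw [add_zero] at this
      refine this.congr fun k => ?_
      field_simp; ring
    have t2 : Tendsto (fun k : ℕ => ((k : ℝ) + 2) ^ (-(1 - α))) atTop (𝓝 0) :=
      (tendsto_rpow_neg_atTop (by linarith)).comp
        (tendsto_atTop_add_const_right _ _ tendsto_natCast_atTop_atTop)
    simpa using (t1.mul t2).const_mul C
  refine Summable.of_nonneg_of_le (fun k => by unfold wrightBound; positivity) (fun k => ?_)
    (hsum.mul_left (2 * (Real.exp α * (Real.exp α * Real.exp α))))
  have h1 : (α * (k + 1) + 1) ^ (α * (k + 1) : ℝ)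
      ≤ (Real.exp α * Real.exp α * Real.exp α ^ k) * ((k + 1).factorial : ℝ) ^ α := by
    have a1 : ((k : ℝ) + 2) ^ (k + 1) ≤ Real.exp (k + 2) * ((k + 1).factorial : ℝ) := by
      rw [← div_le_iff₀ (by positivity)]
      exact Real.pow_div_factorial_le_exp _ (by positivity) _
    calc (α * (k + 1) + 1) ^ (α * (k + 1) : ℝ) ≤ ((k : ℝ) + 2) ^ (α * (k + 1) : ℝ) := by
          have : α * ((k : ℝ) + 1) + 1 ≤ k + 2 := by
            nlinarith [(Nat.cast_nonneg k : (0 : ℝ) ≤ k)]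
          exact Real.rpow_le_rpow (by positivity) this (by positivity)
      _ = (((k : ℝ) + 2) ^ (k + 1)) ^ α := by
          rw [← Real.rpow_natCast, ← Real.rpow_mul (by positivity)]
          push_cast; ring_nf
      _ ≤ (Real.exp (k + 2) * ((k + 1).factorial : ℝ)) ^ α := by gcongr
      _ = _ := by
          rw [Real.mul_rpow (Real.exp_pos _).le (by positivity), ← Real.exp_mul, ← Real.exp_nat_mul,
            ← Real.exp_add, ← Real.exp_add]
          ring_nf
  have h2 : Real.exp (α * (k + 1)) = Real.exp α * Real.exp α ^ k := by
    rw [← Real.exp_nat_mul, ← Real.exp_add]; ring_nf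
  calc z ^ k / (k.factorial : ℝ) * wrightBound α k
      ≤ z ^ k / (k.factorial : ℝ) * (2 * ((Real.exp α * Real.exp α ^ k) *
        ((Real.exp α * Real.exp α * Real.exp α ^ k) * ((k + 1).factorial : ℝ) ^ α))) := by
        rw [wrightBound, h2]; gcongr
    _ = _ := by
        simp only [hT, hC]
        rw [mul_pow, mul_pow]
        ring

/-! ### Mixtures of Gamma densities. -/

/-- The coefficients of the polynomial `p_m` with
`∑ k, (-y)^k / k! * binomCoeff m (α (k + 1)) = exp (-y) * p_m y`. -/
noncomputable def mixCoeff (α : ℝ) : ℕ → ℕ → ℝ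
  | 0, 0 => 1
  | 0, _ + 1 => 0
  | m + 1, 0 => (1 - α / (m + 1)) * mixCoeff α m 0
  | m + 1, i + 1 => (1 - α * (i + 2) / (m + 1)) * mixCoeff α m (i + 1) + α / (m + 1) * mixCoeff α m i

lemma mixCoeff_eq_zero (α : ℝ) {m i : ℕ} (h : m < i) : mixCoeff α m i = 0 := by
  induction m generalizing i with
  | zero => cases i with
    | zero => omega
    | succ i => simp [mixCoeff]
  | succ m ih => cases i with
    | zero => omega
    | succ i => simp [mixCoeff, ih (show m < i + 1 by omega), ih (show m < i by omega)]

/-- The factor 1 - α(i+2)/(m+1) can be negative only if i + 1 > m, and there the coefficient it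
multiplies is zero. -/
lemma mixCoeff_nonneg {α : ℝ} (hα : 0 < α) (hα1 : α < 1) (m i : ℕ) : 0 ≤ mixCoeff α m i := by
  induction m generalizing i with
  | zero => cases i <;> simp [mixCoeff]
  | succ m ih =>
    have hm : (0 : ℝ) < m + 1 := by positivity
    cases i with
    | zero =>
      refine mul_nonneg ?_ (ih 0)
      have : α / ((m : ℝ) + 1) ≤ 1 := by
        rw [div_le_one hm]; linarith [(Nat.cast_nonneg m : (0 : ℝ) ≤ m)]
      linarith
    | succ i =>
      refine add_nonneg ?_ (mul_nonneg (by positivity) (ih i))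
      rcases lt_or_ge m (i + 1) with h | h
      · simp [mixCoeff_eq_zero α h]
      · refine mul_nonneg ?_ (ih _)
        have h' : (i : ℝ) + 1 ≤ m := by exact_mod_cast h
        have : α * ((i : ℝ) + 2) / (m + 1) ≤ 1 := by
          rw [div_le_one hm]; nlinarith [(Nat.cast_nonneg i : (0 : ℝ) ≤ i)]
        linarith

/-- Summation by parts for the recursion of `mixCoeff`. -/
lemma sum_mixCoeff_succ (α : ℝ) (m : ℕ) (w : ℕ → ℝ) :
    ∑ i ∈ Finset.range (m + 2), mixCoeff α (m + 1) i * w i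
      = ∑ i ∈ Finset.range (m + 1), mixCoeff α m i *
          ((1 - α * (i + 1) / (m + 1)) * w i + α / (m + 1) * w (i + 1)) := by
  rw [Finset.sum_range_succ']
  have h1 : ∀ i ∈ Finset.range (m + 1), mixCoeff α (m + 1) (i + 1) * w (i + 1)
      = (1 - α * (((i + 1 : ℕ) : ℝ) + 1) / (m + 1)) * mixCoeff α m (i + 1) * w (i + 1)
        + mixCoeff α m i * (α / (m + 1) * w (i + 1)) := by
    intro i _
    simp only [mixCoeff]; push_cast; ring
  rw [Finset.sum_congr rfl h1, Finset.sum_add_distrib]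
  have h2 : mixCoeff α (m + 1) 0 * w 0
      = (1 - α * (((0 : ℕ) : ℝ) + 1) / (m + 1)) * mixCoeff α m 0 * w 0 := by
    simp [mixCoeff]
  have h3 := Finset.sum_range_succ'
    (fun i : ℕ => (1 - α * ((i : ℝ) + 1) / (m + 1)) * mixCoeff α m i * w i) (m + 1)
  have h4 := Finset.sum_range_succ
    (fun i : ℕ => (1 - α * ((i : ℝ) + 1) / (m + 1)) * mixCoeff α m i * w i) (m + 1)
  rw [mixCoeff_eq_zero α (Nat.lt_succ_self m), mul_zero, zero_mul, add_zero] at h4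
  rw [h4] at h3
  rw [h2, add_right_comm, ← h3, ← Finset.sum_add_distrib]
  exact Finset.sum_congr rfl fun i _ => by ring

/-- The weights w i = i! are a fixed point of the bracket in `sum_mixCoeff_succ`. As i! is the
integral of y^i e^{-y}, this is the total mass of the mixture. -/
lemma sum_mixCoeff_factorial (α : ℝ) (m : ℕ) :
    ∑ i ∈ Finset.range (m + 1), mixCoeff α m i * (i.factorial : ℝ) = 1 := by
  induction m with
  | zero => simp [mixCoeff]
  | succ m ih =>
    rw [sum_mixCoeff_succ]
    refine Eq.trans ?_ ih
    refine Finset.sum_congr rfl fun i _ => ?_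
    rw [Nat.factorial_succ]; push_cast; ring

/-- In the basis of falling factorials, multiplication by k sends the i-th one to the (i+1)-st plus
i times itself, so multiplication by 1 - α(k+1)/(m+1) is the recursion of `mixCoeff`. -/
lemma binomCoeff_eq_sum (α : ℝ) (m k : ℕ) :
    binomCoeff m (α * (k + 1))
      = ∑ i ∈ Finset.range (m + 1), mixCoeff α m i * ((-1) ^ i * (k.descFactorial i : ℝ)) := by
  induction m with
  | zero => simp [binomCoeff, mixCoeff]
  | succ m ih =>
    rw [sum_mixCoeff_succ, binomCoeff_succ, ih, Finset.sum_mul]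
    refine Finset.sum_congr rfl fun i _ => ?_
    have h : (k.descFactorial (i + 1) : ℝ) = (k - i) * k.descFactorial i := by
      rw [Nat.descFactorial_succ, Nat.cast_mul]
      rcases le_or_gt i k with h | h
      · rw [Nat.cast_sub h]
      · rw [Nat.descFactorial_eq_zero_iff_lt.2 h]; simp
    rw [h, pow_succ]
    have hm : (0 : ℝ) < m + 1 := by positivity
    field_simp
    ring

lemma hasSum_descFactorial (i : ℕ) (y : ℝ) :
    HasSum (fun k : ℕ => y ^ k / (k.factorial : ℝ) * (k.descFactorial i : ℝ))
      (y ^ i * Real.exp y) := by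
  have h : HasSum (fun l : ℕ => y ^ i * (y ^ l / (l.factorial : ℝ))) (y ^ i * Real.exp y) := by
    refine HasSum.mul_left _ ?_
    rw [Real.exp_eq_exp_ℝ]
    exact NormedSpace.expSeries_div_hasSum_exp y
  have hinj : Function.Injective fun l : ℕ => l + i := add_left_injective i
  refine (hinj.hasSum_iff ?_).1 (h.congr_fun ?_)
  · intro k hk
    have : k < i := by
      by_contra hki
      exact hk ⟨k - i, by simp only; omega⟩
    simp [Nat.descFactorial_eq_zero_iff_lt.2 this]
  · intro l
    have h1 := Nat.factorial_mul_descFactorial (show i ≤ l + i by omega)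
    rw [Nat.add_sub_cancel] at h1
    have h2 : ((l + i).factorial : ℝ) = l.factorial * ((l + i).descFactorial i : ℝ) := by
      exact_mod_cast h1.symm
    have h3 : ((l + i).descFactorial i : ℝ) ≠ 0 := by
      have : (l + i).descFactorial i ≠ 0 := by
        rw [Ne, Nat.descFactorial_eq_zero_iff_lt]; omega
      exact_mod_cast this
    have h4 : (l.factorial : ℝ) ≠ 0 := by positivity
    simp only [Function.comp]
    rw [h2, pow_add]
    field_simp

/-- A mixture of Gamma densities. -/
noncomputable def mixDensity (α : ℝ) (m : ℕ) (y : ℝ) : ℝ :=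
  ∑ i ∈ Finset.range (m + 1), mixCoeff α m i * (y ^ i * Real.exp (-y))

lemma hasSum_mixDensity (α : ℝ) (m : ℕ) (y : ℝ) :
    HasSum (fun k : ℕ => (-y) ^ k / (k.factorial : ℝ) * binomCoeff m (α * (k + 1)))
      (mixDensity α m y) := by
  have h := hasSum_sum (s := Finset.range (m + 1)) fun i _ =>
    ((hasSum_descFactorial i (-y)).mul_left (mixCoeff α m i * (-1) ^ i))
  convert! h using 1
  · funext k
    rw [binomCoeff_eq_sum, Finset.mul_sum]
    exact Finset.sum_congr rfl fun i _ => by ring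
  · refine Finset.sum_congr rfl fun i _ => ?_
    have : (-1 : ℝ) ^ i * (-y) ^ i = y ^ i := by rw [← mul_pow]; simp
    rw [← this]; ring

lemma mixDensity_nonneg {α : ℝ} (hα : 0 < α) (hα1 : α < 1) (m : ℕ) {y : ℝ} (hy : 0 ≤ y) :
    0 ≤ mixDensity α m y :=
  Finset.sum_nonneg fun i _ => mul_nonneg (mixCoeff_nonneg hα hα1 m i) (by positivity)

lemma continuous_mixDensity (α : ℝ) (m : ℕ) : Continuous (mixDensity α m) := by
  unfold mixDensity; fun_prop

lemma integrableOn_pow_mul_exp_neg (i : ℕ) :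
    IntegrableOn (fun y : ℝ => y ^ i * Real.exp (-y)) (Ioi 0) ∧
      ∫ y in Ioi (0 : ℝ), y ^ i * Real.exp (-y) = i.factorial := by
  have h := Real.GammaIntegral_convergent (s := i + 1) (by positivity)
  have e := Real.Gamma_eq_integral (s := i + 1) (by positivity)
  rw [Real.Gamma_nat_eq_factorial] at e
  have hc : ∀ y ∈ Ioi (0 : ℝ), Real.exp (-y) * y ^ ((i : ℝ) + 1 - 1) = y ^ i * Real.exp (-y) := by
    intro y _
    rw [add_sub_cancel_right, Real.rpow_natCast, mul_comm]
  refine ⟨h.congr_fun hc measurableSet_Ioi, ?_⟩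
  rw [e]
  exact (setIntegral_congr_fun measurableSet_Ioi hc).symm

lemma mixDensity_integral (α : ℝ) (m : ℕ) :
    IntegrableOn (mixDensity α m) (Ioi 0) ∧ ∫ y in Ioi (0 : ℝ), mixDensity α m y = 1 := by
  have hi : ∀ i ∈ Finset.range (m + 1),
      IntegrableOn (fun y : ℝ => mixCoeff α m i * (y ^ i * Real.exp (-y))) (Ioi 0) :=
    fun i _ => (integrableOn_pow_mul_exp_neg i).1.const_mul _
  refine ⟨integrable_finsetSum _ hi, ?_⟩
  unfold mixDensity
  rw [integral_finsetSum _ hi, ← sum_mixCoeff_factorial α m]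
  refine Finset.sum_congr rfl fun i _ => ?_
  rw [integral_const_mul, (integrableOn_pow_mul_exp_neg i).2]

/-- The approximations of the Wright function by rescaled mixtures of Gamma densities. -/
noncomputable def wrightApprox (α : ℝ) (m : ℕ) (z : ℝ) : ℝ :=
  ((m : ℝ) + 1) / m * ((m : ℝ) ^ α * mixDensity α (m + 1) (z * (m : ℝ) ^ α))

/-- Substituting y = z m^α produces m^{αk}, which combines with m^α / m to the power m^{α(k+1)-1} of
Gauss's product. -/
lemma wrightApprox_eq_tsum (α : ℝ) {m : ℕ} (hm : m ≠ 0) (z : ℝ) :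
    wrightApprox α m z
      = ∑' k : ℕ, (-z) ^ k / (k.factorial : ℝ) * invGammaApprox m (α * (k + 1)) := by
  have hm0 : (0 : ℝ) < m := by positivity
  have h := ((hasSum_mixDensity α (m + 1) (z * (m : ℝ) ^ α)).mul_left ((m : ℝ) ^ α)).mul_left
    (((m : ℝ) + 1) / m)
  rw [wrightApprox, ← h.tsum_eq]
  refine tsum_congr fun k => ?_
  have e : (m : ℝ) ^ (α * (k + 1) - 1) = ((m : ℝ) ^ α) ^ k * (m : ℝ) ^ α / m := by
    rw [Real.rpow_sub_one hm0.ne', ← pow_succ, ← Real.rpow_natCast, ← Real.rpow_mul hm0.le]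
    push_cast; rfl
  rw [invGammaApprox, e, ← neg_mul, mul_pow]
  field_simp

/-! ### Convergence to the Wright function; its sign, mass and behaviour at 0. -/

lemma norm_wright_term_le {α : ℝ} (hα : 0 < α) {z w : ℝ} (hzw : |z| ≤ w) {m : ℕ} (hm : m ≠ 0)
    (k : ℕ) : ‖(-z) ^ k / (k.factorial : ℝ) * invGammaApprox m (α * (k + 1))‖
      ≤ w ^ k / (k.factorial : ℝ) * wrightBound α k := by
  have hw : 0 ≤ w := (abs_nonneg z).trans hzw
  rw [norm_mul, norm_div, norm_pow, norm_neg, Real.norm_eq_abs, Real.norm_eq_abs, Nat.abs_cast,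
    Real.norm_eq_abs]
  have := abs_invGammaApprox_le (show 0 ≤ α * ((k : ℝ) + 1) by positivity) hm
  exact mul_le_mul (by gcongr) this (abs_nonneg _) (by positivity)

lemma wright_eq_tsum (α z : ℝ) : wright α z
    = ∑' k : ℕ, (-z) ^ k / (k.factorial : ℝ) * (Real.Gamma (1 - α * (k + 1)))⁻¹ := by
  refine tsum_congr fun k => ?_
  rw [show -α * (k : ℝ) + 1 - α = 1 - α * (k + 1) by ring]
  rw [div_mul_eq_div_div, div_eq_mul_inv _ (Real.Gamma _)]

lemma tendsto_wrightApprox {α : ℝ} (hα : 0 < α) (hα1 : α < 1) (z : ℝ) :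
    Tendsto (fun m => wrightApprox α m z) atTop (𝓝 (wright α z)) := by
  have h : Tendsto (fun m : ℕ =>
      ∑' k : ℕ, (-z) ^ k / (k.factorial : ℝ) * invGammaApprox m (α * (k + 1))) atTop
      (𝓝 (wright α z)) := by
    rw [wright_eq_tsum]
    refine tendsto_tsum_of_dominated_convergence
      (summable_wrightBound hα hα1 (show 0 < |z| + 1 by positivity)) (fun k => ?_) ?_
    · exact (tendsto_invGammaApprox _).const_mul _
    · filter_upwards [eventually_ne_atTop 0] with m hm k
      exact norm_wright_term_le hα (by linarith) hm k
  refine h.congr' ?_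
  filter_upwards [eventually_ne_atTop 0] with m hm
  rw [wrightApprox_eq_tsum α hm]

lemma wright_nonneg {α : ℝ} (hα : 0 < α) (hα1 : α < 1) {z : ℝ} (hz : 0 ≤ z) : 0 ≤ wright α z :=
  ge_of_tendsto' (tendsto_wrightApprox hα hα1 z) fun m =>
    mul_nonneg (by positivity)
      (mul_nonneg (by positivity) (mixDensity_nonneg hα hα1 _ (by positivity)))

lemma continuous_wrightApprox (α : ℝ) (m : ℕ) : Continuous (wrightApprox α m) := by
  have := continuous_mixDensity α (m + 1)
  unfold wrightApprox
  fun_prop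

lemma measurable_wright {α : ℝ} (hα : 0 < α) (hα1 : α < 1) : Measurable (wright α) :=
  measurable_of_tendsto_metrizable (fun m => (continuous_wrightApprox α m).measurable)
    (tendsto_pi_nhds.2 fun z => tendsto_wrightApprox hα hα1 z)

lemma lintegral_wrightApprox {α : ℝ} (hα : 0 < α) (hα1 : α < 1) {m : ℕ} (hm : m ≠ 0) :
    ∫⁻ z in Ioi (0 : ℝ), ENNReal.ofReal (wrightApprox α m z)
      = ENNReal.ofReal (((m : ℝ) + 1) / m) := by
  have hm0 : (0 : ℝ) < m := by positivity
  have hc : 0 < (m : ℝ) ^ α := by positivity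
  obtain ⟨hi, he⟩ := mixDensity_integral α (m + 1)
  have hi' : IntegrableOn (wrightApprox α m) (Ioi 0) := by
    refine (Integrable.const_mul ?_ _).const_mul _
    have := (integrableOn_Ioi_comp_mul_right_iff (mixDensity α (m + 1)) 0 hc).2
    rw [zero_mul] at this
    exact this hi
  rw [← ofReal_integral_eq_lintegral_ofReal hi']
  · congr 1
    unfold wrightApprox
    rw [integral_const_mul, integral_const_mul, integral_comp_mul_right_Ioi _ _ hc, zero_mul, he]
    simp [hc.ne']
  · filter_upwards [ae_restrict_mem measurableSet_Ioi] with z hz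
    have hz' : (0 : ℝ) < z := hz
    exact mul_nonneg (by positivity)
      (mul_nonneg (by positivity) (mixDensity_nonneg hα hα1 _ (by positivity)))

/-- Fatou's lemma for the approximations, whose masses (m+1)/m tend to 1. -/
lemma lintegral_wright_le_one {α : ℝ} (hα : 0 < α) (hα1 : α < 1) :
    ∫⁻ z in Ioi (0 : ℝ), ENNReal.ofReal (wright α z) ≤ 1 := by
  have h1 : ∀ z, ENNReal.ofReal (wright α z)
      = liminf (fun m => ENNReal.ofReal (wrightApprox α m z)) atTop := fun z =>
    ((ENNReal.tendsto_ofReal (tendsto_wrightApprox hα hα1 z)).liminf_eq).symm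
  simp_rw [h1]
  refine (lintegral_liminf_le fun m =>
    (continuous_wrightApprox α m).measurable.ennreal_ofReal).trans ?_
  have h2 : Tendsto (fun m : ℕ => ∫⁻ z in Ioi (0 : ℝ), ENNReal.ofReal (wrightApprox α m z)) atTop
      (𝓝 1) := by
    have t : Tendsto (fun m : ℕ => ((m : ℝ) + 1) / m) atTop (𝓝 1) := by
      have : Tendsto (fun m : ℕ => 1 + 1 / (m : ℝ)) atTop (𝓝 (1 + 0)) :=
        tendsto_const_nhds.add tendsto_one_div_atTop_nhds_zero_nat
      rw [add_zero] at this
      refine this.congr' ?_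
      filter_upwards [eventually_ne_atTop 0] with m hm
      field_simp
    have := ENNReal.tendsto_ofReal t
    rw [ENNReal.ofReal_one] at this
    refine this.congr' ?_
    filter_upwards [eventually_ne_atTop 0] with m hm
    rw [lintegral_wrightApprox hα hα1 hm]
  exact h2.liminf_eq.le

lemma continuousOn_wright {α : ℝ} (hα : 0 < α) (hα1 : α < 1) :
    ContinuousOn (wright α) (Icc 0 1) := by
  have e : wright α = fun z => ∑' k : ℕ, (-z) ^ k / (k.factorial : ℝ) *
      (Real.Gamma (1 - α * (k + 1)))⁻¹ := funext fun z => wright_eq_tsum α z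
  rw [e]
  refine continuousOn_tsum (fun k => by fun_prop) (summable_wrightBound hα hα1 one_pos)
    fun k z hz => ?_
  refine le_of_tendsto ((tendsto_invGammaApprox (α * (k + 1))).const_mul _).norm ?_
  filter_upwards [eventually_ne_atTop 0] with m hm
  exact norm_wright_term_le hα (by rw [abs_of_nonneg hz.1]; exact hz.2) hm k

lemma wright_zero_pos {α : ℝ} (hα1 : α < 1) : 0 < wright α 0 := by
  rw [wright_eq_tsum, tsum_eq_single 0]
  · simpa using Real.Gamma_pos_of_pos (show 0 < 1 - α by linarith)
  · intro k hk
    simp [hk]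

/-- The measure with density `Φ_α` on the half line. -/
noncomputable def wrightMeasure (α : ℝ) : Measure ℝ :=
  (volume.restrict (Ioi (0 : ℝ))).withDensity fun z => ENNReal.ofReal (wright α z)

lemma wrightMeasure_univ_le_one {α : ℝ} (hα : 0 < α) (hα1 : α < 1) :
    wrightMeasure α univ ≤ 1 := by
  rw [wrightMeasure, withDensity_apply _ MeasurableSet.univ, Measure.restrict_univ]
  exact lintegral_wright_le_one hα hα1

/-- Φ_α(0) = 1/Γ(1 - α) > 0, and continuity keeps the density positive on some (0, δ]. -/
lemma wrightMeasure_ne_zero {α : ℝ} (hα : 0 < α) (hα1 : α < 1) : wrightMeasure α ≠ 0 := by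
  intro h
  rw [wrightMeasure, withDensity_eq_zero_iff
    (measurable_wright hα hα1).ennreal_ofReal.aemeasurable] at h
  have hc := (continuousOn_wright hα hα1) 0 ⟨le_rfl, zero_le_one⟩
  have hev : ∀ᶠ z in 𝓝[>] (0 : ℝ), 0 < wright α z :=
    (hc.mono_left (nhdsWithin_le_of_mem (mem_nhdsGT_iff_exists_Ioc_subset.2
      ⟨1, one_pos, fun z hz => ⟨hz.1.le, hz.2⟩⟩))).eventually (lt_mem_nhds (wright_zero_pos hα1))
  obtain ⟨δ, hδ, hsub⟩ := mem_nhdsGT_iff_exists_Ioc_subset.1 hev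
  have hδ0 : (0 : ℝ) < δ := hδ
  have hz : volume (Ioc (0 : ℝ) δ) = 0 := by
    rw [Filter.EventuallyEq, ae_restrict_iff' measurableSet_Ioi] at h
    refine measure_mono_null (fun z hz => ?_) h
    intro hcon
    have h1 : 0 < wright α z := hsub hz
    have h2 := hcon hz.1
    simp only [Pi.zero_apply, ENNReal.ofReal_eq_zero] at h2
    linarith
  simp [hδ0.not_ge] at hz

lemma ae_wrightMeasure_pos (α : ℝ) : ∀ᵐ z ∂(wrightMeasure α), 0 < z :=
  (withDensity_absolutelyContinuous _ _).ae_le (ae_restrict_mem measurableSet_Ioi)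

lemma integral_wrightMeasure {α : ℝ} (hα : 0 < α) (hα1 : α < 1) (f : ℝ → ℝ) :
    ∫ z, f z ∂(wrightMeasure α) = ∫ z in Ioi (0 : ℝ), wright α z * f z := by
  rw [wrightMeasure, integral_withDensity_eq_integral_toReal_smul
    (measurable_wright hα hα1).ennreal_ofReal (by simp)]
  refine setIntegral_congr_fun measurableSet_Ioi fun z hz => ?_
  simp only [smul_eq_mul]
  rw [ENNReal.toReal_ofReal (wright_nonneg hα hα1 (le_of_lt hz))]

/-! ### Semigroups generated by the inverse of a bounded positive operator -/

section Construction

variable {H : Type*} [NormedAddCommGroup H]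

lemma tendsto_of_denseRange {ι : Type*} {l : Filter ι} {Q : ι → H → H} {Q' : H → H} {C : ℝ}
    {J : H → H} (hJ : DenseRange J)
    (hQ : ∀ᶠ i in l, ∀ x y, ‖Q i x - Q i y‖ ≤ C * ‖x - y‖)
    (hQ' : ∀ x y, ‖Q' x - Q' y‖ ≤ C * ‖x - y‖)
    (h : ∀ z, Tendsto (fun i => Q i (J z)) l (𝓝 (Q' (J z)))) (x : H) :
    Tendsto (fun i => Q i x) l (𝓝 (Q' x)) := by
  rw [Metric.tendsto_nhds]
  intro ε hε
  have hC : 0 < 2 * |C| + 1 := by positivity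
  obtain ⟨z, hz⟩ := hJ.exists_dist_lt x (show 0 < ε / (2 * |C| + 1) / 2 by positivity)
  have h2 := (Metric.tendsto_nhds.1 (h z)) (ε / 2) (by positivity)
  filter_upwards [h2, hQ] with i hi hQi
  rw [dist_eq_norm] at hi hz ⊢
  have e : Q i x - Q' x = (Q i x - Q i (J z)) + (Q i (J z) - Q' (J z)) - (Q' x - Q' (J z)) := by abel
  have hz' : (2 * |C| + 1) * ‖x - J z‖ < ε / 2 := by
    rw [lt_div_iff₀ two_pos, lt_div_iff₀ hC] at hz; linarith
  have a1 := hQi x (J z)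
  have a2 := hQ' x (J z)
  have a3 : C * ‖x - J z‖ ≤ |C| * ‖x - J z‖ := by gcongr; exact le_abs_self C
  have a4 := norm_sub_le ((Q i x - Q i (J z)) + (Q i (J z) - Q' (J z))) (Q' x - Q' (J z))
  have a5 := norm_add_le (Q i x - Q i (J z)) (Q i (J z) - Q' (J z))
  rw [e]
  nlinarith [norm_nonneg (x - J z)]

lemma cauchySeq_of_denseRange {Q : ℕ → H → H} {J : H → H} (hJ : DenseRange J)
    (hQ : ∀ i x y, ‖Q i x - Q i y‖ ≤ ‖x - y‖) (h : ∀ z, CauchySeq fun i => Q i (J z)) (x : H) :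
    CauchySeq fun i => Q i x := by
  rw [Metric.cauchySeq_iff]
  intro ε hε
  obtain ⟨z, hz⟩ := hJ.exists_dist_lt x (show 0 < ε / 3 by positivity)
  obtain ⟨N, hN⟩ := Metric.cauchySeq_iff.1 (h z) (ε / 3) (by positivity)
  refine ⟨N, fun m hm k hk => ?_⟩
  have h1 := hN m hm k hk
  rw [dist_eq_norm] at h1 hz ⊢
  have e : Q m x - Q k x
      = (Q m x - Q m (J z)) + (Q m (J z) - Q k (J z)) - (Q k x - Q k (J z)) := by abel
  have a1 := hQ m x (J z)
  have a2 := hQ k x (J z)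
  have a4 := norm_sub_le ((Q m x - Q m (J z)) + (Q m (J z) - Q k (J z))) (Q k x - Q k (J z))
  have a5 := norm_add_le (Q m x - Q m (J z)) (Q m (J z) - Q k (J z))
  rw [e]
  linarith

variable [InnerProductSpace ℝ H] [CompleteSpace H]

lemma hasDerivAt_exp_smul_apply (Y : H →L[ℝ] H) (x : H) (t : ℝ) :
    HasDerivAt (fun s : ℝ => NormedSpace.exp (s • Y) x) (NormedSpace.exp (t • Y) (Y x)) t := by
  have h := (hasDerivAt_exp_smul_const Y t).clm_apply (hasDerivAt_const t x)
  simpa using h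

/-- With v = e^{-sY}x, the derivative of ‖v‖² in s is -2⟨Yv, v⟩ ≤ 0. -/
lemma norm_exp_neg_le {Y : H →L[ℝ] H} (hY : ∀ x, 0 ≤ inner ℝ (Y x) x) {t : ℝ} (ht : 0 ≤ t)
    (x : H) : ‖NormedSpace.exp (t • -Y) x‖ ≤ ‖x‖ := by
  have hd : ∀ s : ℝ, HasDerivAt (fun s : ℝ => ‖NormedSpace.exp (s • -Y) x‖ ^ 2)
      (2 * inner ℝ (NormedSpace.exp (s • -Y) x) (-(Y (NormedSpace.exp (s • -Y) x)))) s := by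
    intro s
    have h := (hasDerivAt_exp_smul_apply (-Y) x s).norm_sq
    have hc : Commute (NormedSpace.exp (s • -Y)) (-Y) :=
      (((Commute.refl (-Y)).smul_right s).exp_right).symm
    have e : NormedSpace.exp (s • -Y) ((-Y) x) = -(Y (NormedSpace.exp (s • -Y) x)) :=
      DFunLike.congr_fun hc.eq x
    rwa [e] at h
  have hanti : Antitone fun s : ℝ => ‖NormedSpace.exp (s • -Y) x‖ ^ 2 := by
    refine antitone_of_deriv_nonpos (fun s => (hd s).differentiableAt) fun s => ?_
    rw [(hd s).deriv, inner_neg_right, real_inner_comm]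
    have := hY (NormedSpace.exp (s • -Y) x)
    linarith
  have := hanti ht
  simp only [zero_smul, NormedSpace.exp_zero, one_apply_eq_self] at this
  exact le_of_sq_le_sq this (norm_nonneg _) 

/-- Interpolate by s ↦ e^{s(Z-Y)} e^{-tZ} x on [0, t]. By commutation this is e^{-(sY + (t-s)Z)} x,
an orbit of contractions, so its derivative is bounded by ‖Zx - Yx‖. -/
lemma norm_exp_sub_exp_le {Y Z : H →L[ℝ] H} (hYZ : Commute Y Z)
    (hY : ∀ x, 0 ≤ inner ℝ (Y x) x) (hZ : ∀ x, 0 ≤ inner ℝ (Z x) x) {t : ℝ} (ht : 0 ≤ t) (x : H) :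
    ‖NormedSpace.exp (t • -Y) x - NormedSpace.exp (t • -Z) x‖ ≤ t * ‖Y x - Z x‖ := by
  have hc : ∀ s : ℝ, Commute (s • (Z - Y)) (t • -Z) := fun s =>
    ((((Commute.refl Z).sub_left hYZ).neg_right).smul_right t).smul_left s
  have hsplit : ∀ s : ℝ, ∀ v, NormedSpace.exp (s • (Z - Y)) (NormedSpace.exp (t • -Z) v)
      = NormedSpace.exp ((1 : ℝ) • -(s • Y + (t - s) • Z)) v := by
    intro s v
    let _ : NormedAlgebra ℚ (H →L[ℝ] H) := NormedAlgebra.restrictScalars ℚ ℝ _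
    rw [← mul_apply_eq_comp, ← NormedSpace.exp_add_of_commute (hc s)]
    congr 2
    module
  have hd : ∀ s : ℝ, HasDerivAt
      (fun s : ℝ => NormedSpace.exp (s • (Z - Y)) (NormedSpace.exp (t • -Z) x))
      (NormedSpace.exp (s • (Z - Y)) (NormedSpace.exp (t • -Z) ((Z - Y) x))) s := by
    intro s
    have h := hasDerivAt_exp_smul_apply (Z - Y) (NormedSpace.exp (t • -Z) x) s
    have hc' : Commute (Z - Y) (NormedSpace.exp (t • -Z)) := by
      have := (hc 1).exp_right
      rwa [one_smul] at this
    have e : (Z - Y) (NormedSpace.exp (t • -Z) x) = NormedSpace.exp (t • -Z) ((Z - Y) x) :=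
      DFunLike.congr_fun hc'.eq x
    rwa [e] at h
  have h := norm_image_sub_le_of_norm_deriv_le_segment' (C := ‖Y x - Z x‖) (a := 0) (b := t)
    (fun s _ => (hd s).hasDerivWithinAt) (fun s hs => ?_) t ⟨ht, le_rfl⟩
  · rw [hsplit, hsplit] at h
    simp only [sub_self, zero_smul, add_zero, sub_zero, zero_add, one_smul] at h
    rw [smul_neg, smul_neg, mul_comm]
    exact h
  · rw [hsplit, norm_sub_rev (Y x)]
    refine norm_exp_neg_le (fun v => ?_) zero_le_one _
    simp only [add_apply, smul_apply, inner_add_left,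
      real_inner_smul_left]
    have := hY v
    have := hZ v
    have h1 := hs.1
    have h2 : 0 ≤ t - s := by linarith [hs.2]
    positivity

lemma norm_exp_taylor_le {Y : H →L[ℝ] H} (hY : ∀ x, 0 ≤ inner ℝ (Y x) x) {t : ℝ} (ht : 0 ≤ t)
    (x : H) : ‖NormedSpace.exp (t • -Y) x - x + t • Y x‖ ≤ t * ‖Y (Y x)‖ * t := by
  have h0 : ∀ s : ℝ, 0 ≤ s → ∀ v, ‖NormedSpace.exp (s • -Y) v - v‖ ≤ s * ‖Y v‖ := by
    intro s hs v
    have := norm_exp_sub_exp_le (Commute.zero_right Y) hY (Z := 0) (by simp) hs v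
    simpa using this
  have hd : ∀ s : ℝ, HasDerivAt (fun s : ℝ => NormedSpace.exp (s • -Y) x - x + s • Y x)
      (-(NormedSpace.exp (s • -Y) (Y x) - Y x)) s := by
    intro s
    have h1 := hasDerivAt_exp_smul_apply (-Y) x s
    have h2 := (h1.sub_const x).add ((hasDerivAt_id s).smul_const (Y x))
    refine h2.congr_deriv ?_
    simp [← sub_eq_neg_add]
  have h := norm_image_sub_le_of_norm_deriv_le_segment' (C := t * ‖Y (Y x)‖) (a := 0) (b := t)
    (fun s _ => (hd s).hasDerivWithinAt) (fun s hs => ?_) t ⟨ht, le_rfl⟩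
  · simpa using h
  · rw [norm_neg]
    refine (h0 s hs.1 _).trans ?_
    gcongr
    exact hs.2.le

/-- The Yosida approximations `(R + ε)⁻¹` of `R⁻¹`. -/
lemma exists_yosida {R : H →L[ℝ] H} (hR : IsSelfAdjoint R) (hpos : ∀ x, 0 ≤ inner ℝ (R x) x)
    {ε : ℝ} (hε : 0 < ε) :
    ∃ Y : H →L[ℝ] H, IsSelfAdjoint Y ∧ (∀ x, 0 ≤ inner ℝ (Y x) x) ∧
      (∀ K, Commute K R → Commute K Y) ∧ (∀ z, ‖Y (R z)‖ ≤ ‖z‖) ∧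
      ∀ z, ‖Y (R (R z)) - R z‖ ≤ ε * ‖z‖ := by
  have hu : IsUnit (R + ε • (1 : H →L[ℝ] H)) := by
    refine ContinuousLinearMap.isUnit_of_forall_le_norm_inner_map _ (c := ε.toNNReal)
      (Real.toNNReal_pos.2 hε) fun x => ?_
    rw [add_apply, inner_add_left, smul_apply,
      one_apply_eq_self, real_inner_smul_left, real_inner_self_eq_norm_sq,
      Real.norm_of_nonneg (add_nonneg (hpos x) (by positivity))]
    have := hpos x
    rw [Real.coe_toNNReal _ hε.le]
    linarith
  obtain ⟨U, hU⟩ := hu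
  have hUY : ∀ x, R ((↑U⁻¹ : H →L[ℝ] H) x) + ε • (↑U⁻¹ : H →L[ℝ] H) x = x := fun x => by
    have := DFunLike.congr_fun U.mul_inv x
    rw [hU] at this
    simpa using this
  have hcomm : ∀ K, Commute K R → Commute K (↑U⁻¹ : H →L[ℝ] H) := fun K hK => by
    refine Commute.units_inv_right ?_
    rw [hU]
    exact hK.add_right ((Commute.one_right K).smul_right ε)
  have hYR : ∀ x, (↑U⁻¹ : H →L[ℝ] H) (R x) = R ((↑U⁻¹ : H →L[ℝ] H) x) := fun x =>
    (DFunLike.congr_fun (hcomm R (Commute.refl R)).eq x).symm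
  have hcontr : ∀ z, ‖(↑U⁻¹ : H →L[ℝ] H) (R z)‖ ≤ ‖z‖ := fun z => by
    rw [hYR]
    set w := (↑U⁻¹ : H →L[ℝ] H) z with hw
    have hz := hUY z
    rw [← hw] at hz
    refine le_of_sq_le_sq ?_ (norm_nonneg _)
    -- With z = Rw + εw, ‖z‖² is ‖Rw‖² plus two nonnegative terms.
    rw [← hz, norm_add_sq_real, real_inner_smul_right]
    have := hpos w
    have : 0 ≤ ε * inner ℝ (R w) w := by positivity
    nlinarith [sq_nonneg ‖ε • w‖]
  refine ⟨↑U⁻¹, ?_, fun x => ?_, hcomm, hcontr, fun z => ?_⟩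
  · rw [← Ring.inverse_unit, hU]
    exact (hR.add ((IsSelfAdjoint.all ε).smul (IsSelfAdjoint.one _))).ringInverse
  · set w := (↑U⁻¹ : H →L[ℝ] H) x with hw
    have hz := hUY x
    rw [← hw] at hz
    rw [← hz, inner_add_right, real_inner_smul_right, real_inner_self_eq_norm_sq, real_inner_comm]
    have := hpos w
    positivity
  · have h1 := hUY (R z)
    rw [← hYR] at h1
    have h2 : (↑U⁻¹ : H →L[ℝ] H) (R (R z)) - R z = -(ε • (↑U⁻¹ : H →L[ℝ] H) (R z)) := by
      rw [eq_sub_of_add_eq h1]; abel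
    rw [h2, norm_neg, norm_smul, Real.norm_of_nonneg hε.le]
    gcongr
    exact hcontr z

/-- `S` is the strongly continuous semigroup of symmetric contractions generated by `-R⁻¹`. -/
structure IsContractionSemigroup (R : H →L[ℝ] H) (S : ℝ → H →L[ℝ] H) : Prop where
  map_zero : S 0 = 1
  map_add : ∀ s t : ℝ, 0 ≤ s → 0 ≤ t → S (s + t) = S s * S t
  norm_le : ∀ t x, ‖S t x‖ ≤ ‖x‖
  symm : ∀ t x y, inner ℝ (S t x) y = inner ℝ x (S t y)
  continuous : ∀ x, Continuous fun t => S t x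
  norm_sub_le : ∀ t, 0 ≤ t → ∀ y, ‖S t (R y) - R y‖ ≤ t * ‖y‖
  commute : ∀ K, Commute K R → ∀ t, Commute K (S t)
  tendsto : ∀ y, Tendsto (fun h : ℝ => h⁻¹ • (S h (R y) - R y)) (𝓝[>] 0) (𝓝 (-y))

lemma denseRange_of_injective {R : H →L[ℝ] H} (hR : IsSelfAdjoint R)
    (hinj : Function.Injective R) : DenseRange R := by
  have h1 : R.toLinearMap.rangeᗮ = ⊥ := by
    rw [ContinuousLinearMap.orthogonal_range, hR.adjoint_eq]
    exact LinearMap.ker_eq_bot.2 hinj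
  have h2 := (Submodule.topologicalClosure_eq_top_iff).2 h1
  exact Submodule.dense_iff_topologicalClosure_eq_top.2 h2

/-- Hille–Yosida in the commuting symmetric case. On the dense range of R² the Yosida approximations
converge at rate 1/(k+1), so their exponentials are Cauchy there, uniformly for bounded t;
contractivity extends the convergence to all vectors. -/
theorem exists_isContractionSemigroup {R : H →L[ℝ] H} (hR : IsSelfAdjoint R)
    (hpos : ∀ x, 0 ≤ inner ℝ (R x) x) (hinj : Function.Injective R) :
    ∃ S, IsContractionSemigroup R S := by
  have hδ : ∀ k : ℕ, (0 : ℝ) < 1 / ((k : ℝ) + 1) := fun k => by positivity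
  choose Y hYsa hYpos hYcomm hYR hYRR using fun k : ℕ => exists_yosida hR hpos (hδ k)
  have hYR' : ∀ k z, Y k (R z) = R (Y k z) := fun k z =>
    (DFunLike.congr_fun (hYcomm k R (Commute.refl R)).eq z).symm
  have hdR := denseRange_of_injective hR hinj
  have hdRR : DenseRange fun z => R (R z) := hdR.comp hdR R.continuous
  -- Truncating at `max t 0` makes contractivity and continuity hold for all real t; the limit is
  -- the identity for t < 0.
  set E : ℕ → ℝ → H →L[ℝ] H := fun k t => NormedSpace.exp ((max t 0) • -(Y k)) with hE
  have hEnorm : ∀ k t x, ‖E k t x‖ ≤ ‖x‖ := fun k t x =>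
    norm_exp_neg_le (hYpos k) (le_max_right t 0) x
  have hElip : ∀ k t x y, ‖E k t x - E k t y‖ ≤ ‖x - y‖ := fun k t x y => by
    rw [← map_sub]; exact hEnorm k t _
  have hYY : ∀ i j, Commute (Y i) (Y j) := fun i j => hYcomm j _ (hYcomm i R (Commute.refl R)).symm
  have hEdiff : ∀ i j t z, ‖E i t (R (R z)) - E j t (R (R z))‖
      ≤ max t 0 * ((1 / ((i : ℝ) + 1) + 1 / ((j : ℝ) + 1)) * ‖z‖) := by
    intro i j t z
    refine (norm_exp_sub_exp_le (hYY i j) (hYpos i) (hYpos j) (le_max_right t 0) _).trans ?_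
    gcongr
    have e : Y i (R (R z)) - Y j (R (R z)) = (Y i (R (R z)) - R z) - (Y j (R (R z)) - R z) := by
      abel
    rw [e, add_mul]
    exact (norm_sub_le _ _).trans (add_le_add (hYRR i z) (hYRR j z))
  have hcau : ∀ t x, CauchySeq fun k => E k t x := by
    intro t x
    refine cauchySeq_of_denseRange (Q := fun k => E k t) hdRR (fun k => hElip k t) (fun z => ?_) x
    refine cauchySeq_of_le_tendsto_0' (fun k : ℕ => max t 0 * (2 * (1 / ((k : ℝ) + 1)) * ‖z‖))
      (fun i j hij => ?_) ?_
    · rw [dist_eq_norm]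
      refine (hEdiff i j t z).trans ?_
      have : 1 / ((j : ℝ) + 1) ≤ 1 / ((i : ℝ) + 1) := by gcongr
      gcongr
      linarith
    · have := ((tendsto_one_div_add_atTop_nhds_zero_nat (𝕜 := ℝ)).const_mul 2).mul_const ‖z‖
      simpa using this.const_mul (max t 0)
  choose f hf using fun t x => cauchySeq_tendsto_of_complete (hcau t x)
  set S : ℝ → H →L[ℝ] H := fun t =>
    continuousLinearMapOfTendsto (fun k => E k t) (tendsto_pi_nhds.2 (hf t)) with hS
  have hlim : ∀ t x, Tendsto (fun k => E k t x) atTop (𝓝 (S t x)) := hf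
  have hSnorm : ∀ t x, ‖S t x‖ ≤ ‖x‖ := fun t x =>
    le_of_tendsto' (hlim t x).norm fun k => hEnorm k t x
  have hSlip : ∀ t x y, ‖S t x - S t y‖ ≤ ‖x - y‖ := fun t x y => by
    rw [← map_sub]; exact hSnorm t _
  have hsub : ∀ t, 0 ≤ t → ∀ y, ‖S t (R y) - R y‖ ≤ t * ‖y‖ := by
    intro t ht y
    refine le_of_tendsto' ((hlim t (R y)).sub_const (R y)).norm fun k => ?_
    have h := norm_exp_sub_exp_le (Commute.zero_right (Y k)) (hYpos k) (Z := 0) (by simp)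
      (le_max_right t 0) (R y)
    simp only [neg_zero, smul_zero, NormedSpace.exp_zero, one_apply_eq_self,
      zero_apply, sub_zero] at h
    rw [max_eq_left ht] at h
    refine le_trans ?_ (h.trans (by gcongr; exact hYR k y))
    simp [hE, max_eq_left ht]
  have htaylor : ∀ t, 0 ≤ t → ∀ z, ‖S t (R (R z)) - R (R z) + t • R z‖ ≤ t * ‖z‖ * t := by
    intro t ht z
    have hY1 : Tendsto (fun k => Y k (R (R z))) atTop (𝓝 (R z)) := by
      rw [tendsto_iff_norm_sub_tendsto_zero]
      refine squeeze_zero (fun _ => norm_nonneg _) (fun k => hYRR k z) ?_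
      simpa using (tendsto_one_div_add_atTop_nhds_zero_nat (𝕜 := ℝ)).mul_const ‖z‖
    refine le_of_tendsto' (((hlim t (R (R z))).sub_const (R (R z))).add
      (hY1.const_smul t)).norm fun k => ?_
    have h := norm_exp_taylor_le (hYpos k) ht (R (R z))
    have e : Y k (Y k (R (R z))) = Y k (R (Y k (R z))) := by rw [hYR' k (R z)]
    simp only [hE, max_eq_left ht]
    refine h.trans ?_
    gcongr
    rw [e]
    exact (hYR k _).trans (hYR k z)
  refine ⟨S, ?_, ?_, hSnorm, ?_, ?_, hsub, ?_, ?_⟩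
  · ext x
    refine tendsto_nhds_unique (hlim 0 x) ?_
    simp [hE]
  · intro s t hs ht
    ext x
    rw [mul_apply_eq_comp]
    refine tendsto_nhds_unique (hlim (s + t) x) ?_
    have h1 : ∀ k, E k (s + t) x = E k s (E k t x) := by
      intro k
      let _ : NormedAlgebra ℚ (H →L[ℝ] H) := NormedAlgebra.restrictScalars ℚ ℝ _
      simp only [hE, max_eq_left hs, max_eq_left ht, max_eq_left (add_nonneg hs ht)]
      rw [← mul_apply_eq_comp, ← NormedSpace.exp_add_of_commute, add_smul]
      exact ((Commute.refl _).smul_right t).smul_left s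
    simp_rw [h1]
    have h2 : Tendsto (fun k => E k s (E k t x) - E k s (S t x)) atTop (𝓝 0) := by
      refine squeeze_zero_norm (fun k => hElip k s _ _) ?_
      exact tendsto_iff_norm_sub_tendsto_zero.1 (hlim t x)
    simpa using h2.add (hlim s (S t x))
  · intro t x y
    refine tendsto_nhds_unique ((hlim t x).inner tendsto_const_nhds)
      ((tendsto_const_nhds.inner (hlim t y)).congr fun k => ?_)
    have : IsSelfAdjoint (E k t) := ((IsSelfAdjoint.all (max t 0)).smul (hYsa k).neg).exp
    exact ((ContinuousLinearMap.isSelfAdjoint_iff_isSymmetric.1 this) x y).symm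
  · intro x
    have hRR : ∀ z, Continuous fun t => S t (R (R z)) := by
      intro z
      refine continuous_iff_continuousAt.2 fun t₀ => ?_
      have hu : TendstoUniformlyOn (fun k t => E k t (R (R z))) (fun t => S t (R (R z))) atTop
          (Iio (t₀ + 1)) := by
        rw [Metric.tendstoUniformlyOn_iff]
        intro ε hε
        set M := max (t₀ + 1) 0 with hM
        have hl : Tendsto (fun k : ℕ => M * (1 / ((k : ℝ) + 1) * ‖z‖)) atTop (𝓝 0) := by
          have := (tendsto_one_div_add_atTop_nhds_zero_nat (𝕜 := ℝ)).mul_const ‖z‖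
          simpa using this.const_mul M
        filter_upwards [hl.eventually (gt_mem_nhds hε)] with k hk t ht
        refine lt_of_le_of_lt ?_ hk
        rw [dist_comm, dist_eq_norm]
        have hl2 : Tendsto (fun j : ℕ => max t 0 * ((1 / ((k : ℝ) + 1) + 1 / ((j : ℝ) + 1)) * ‖z‖))
            atTop (𝓝 (max t 0 * ((1 / ((k : ℝ) + 1) + 0) * ‖z‖))) :=
          (((tendsto_one_div_add_atTop_nhds_zero_nat (𝕜 := ℝ)).const_add _).mul_const _).const_mul _
        have := le_of_tendsto_of_tendsto' ((hlim t (R (R z))).const_sub (E k t (R (R z)))).norm hl2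
          fun j => hEdiff k j t z
        refine this.trans ?_
        rw [add_zero]
        gcongr
        exact max_le_max_right 0 (le_of_lt ht)
      refine (hu.continuousOn (Frequently.of_forall fun k => ?_)).continuousAt
        (Iio_mem_nhds (by linarith))
      have : Continuous fun s : ℝ => NormedSpace.exp (s • -(Y k)) (R (R z)) :=
        continuous_iff_continuousAt.2 fun s => (hasDerivAt_exp_smul_apply _ _ s).continuousAt
      exact (this.comp (continuous_id.max continuous_const)).continuousOn
    refine continuous_iff_continuousAt.2 fun t₀ => ?_
    refine tendsto_of_denseRange (Q := fun t => S t) (Q' := S t₀) (C := 1) hdRR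
      (Eventually.of_forall fun t x y => ?_) (fun x y => ?_) (fun z => (hRR z).continuousAt) x
    · rw [one_mul]; exact hSlip t x y
    · rw [one_mul]; exact hSlip t₀ x y
  · intro K hK t
    ext x
    simp only [mul_apply_eq_comp]
    refine tendsto_nhds_unique ((K.continuous.tendsto _).comp (hlim t x))
      ((hlim t (K x)).congr fun k => ?_)
    have : Commute K (E k t) := (((hYcomm k K hK).neg_right).smul_right _).exp_right
    exact (DFunLike.congr_fun this.eq x).symm
  · intro y
    -- The difference quotients on the range of R are 1-Lipschitz in y by `hsub`, so it suffices to
    -- treat y = R z, where `htaylor` gives the error h‖z‖.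
    refine tendsto_of_denseRange (Q := fun (h : ℝ) y => h⁻¹ • (S h (R y) - R y))
      (Q' := fun y => -y) (C := 1) (J := R) hdR ?_ (fun x y => ?_) (fun z => ?_) y
    · filter_upwards [self_mem_nhdsWithin] with h hh x y
      have hh0 : (0 : ℝ) < h := hh
      rw [← smul_sub, norm_smul, norm_inv, Real.norm_of_nonneg hh0.le, one_mul,
        inv_mul_le_iff₀ hh0]
      have := hsub h hh0.le (x - y)
      rw [map_sub, map_sub] at this
      convert! this using 2
      abel
    · rw [one_mul, ← neg_sub' , norm_neg]
    · rw [tendsto_iff_norm_sub_tendsto_zero]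
      have hl : Tendsto (fun h : ℝ => h * ‖z‖) (𝓝[>] 0) (𝓝 0) := by
        have : Tendsto (fun h : ℝ => h * ‖z‖) (𝓝 0) (𝓝 (0 * ‖z‖)) := tendsto_id.mul_const _
        rw [zero_mul] at this
        exact this.mono_left nhdsWithin_le_nhds
      refine squeeze_zero' (Eventually.of_forall fun _ => norm_nonneg _) ?_ hl
      filter_upwards [self_mem_nhdsWithin] with h hh
      have hh0 : (0 : ℝ) < h := hh
      have e : h⁻¹ • (S h (R (R z)) - R (R z)) - -R z
          = h⁻¹ • (S h (R (R z)) - R (R z) + h • R z) := by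
        rw [smul_add, smul_smul, inv_mul_cancel₀ hh0.ne', one_smul, sub_neg_eq_add]
      rw [e, norm_smul, norm_inv, Real.norm_of_nonneg hh0.le, inv_mul_le_iff₀ hh0]
      have := htaylor h hh0.le z
      linarith

end Construction

/-! ### Inverses and semigroups of strictly positive self-adjoint operators -/

section Generator

variable {H : Type*} [NormedAddCommGroup H] [InnerProductSpace ℝ H]

namespace IsContractionSemigroup

variable {R : H →L[ℝ] H} {S : ℝ → H →L[ℝ] H} (hS : IsContractionSemigroup R S)
include hS

lemma apply_inverse_comm (t : ℝ) (y : H) : S t (R y) = R (S t y) :=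
  (DFunLike.congr_fun (hS.commute R (Commute.refl R) t).eq y).symm

lemma tendsto_apply {ι : Type*} {l : Filter ι} {r : ι → ℝ} {v : ι → H} {t : ℝ} {x : H}
    (hr : Tendsto r l (𝓝 t)) (hv : Tendsto v l (𝓝 x)) :
    Tendsto (fun i => S (r i) (v i)) l (𝓝 (S t x)) := by
  have h1 : Tendsto (fun i => S (r i) (v i - x)) l (𝓝 0) := by
    refine squeeze_zero_norm (fun i => hS.norm_le _ _) ?_
    exact tendsto_iff_norm_sub_tendsto_zero.1 hv
  have h2 := h1.add (((hS.continuous x).tendsto t).comp hr)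
  rw [zero_add] at h2
  refine h2.congr fun i => ?_
  simp [map_sub]

lemma continuous_apply {X : Type*} [TopologicalSpace X] {r : X → ℝ} {v : X → H}
    (hr : Continuous r) (hv : Continuous v) : Continuous fun a => S (r a) (v a) :=
  continuous_iff_continuousAt.2 fun a => hS.tendsto_apply (hr.tendsto a) (hv.tendsto a)

lemma isC0Semigroup : IsC0Semigroup S :=
  ⟨hS.map_zero, hS.map_add, fun x => (hS.continuous x).continuousOn⟩

/-- A right derivative of `r ↦ S (t - r) (v r)`. -/
lemma hasDerivWithinAt_sub {v : ℝ → H} {v' w : H} {s t : ℝ} (hst : s < t)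
    (hv : HasDerivWithinAt v v' (Ioi s) s) (hw : v s = R w) :
    HasDerivWithinAt (fun r => S (t - r) (v r)) (S (t - s) (v' + w)) (Ioi s) s := by
  rw [hasDerivWithinAt_iff_tendsto_slope' self_notMem_Ioi] at hv ⊢
  have h0 : Tendsto (fun r : ℝ => r - s) (𝓝[>] s) (𝓝[>] 0) := by
    refine tendsto_nhdsWithin_iff.2 ⟨?_, ?_⟩
    · have : Tendsto (fun r : ℝ => r - s) (𝓝 s) (𝓝 (s - s)) := tendsto_id.sub_const s
      rw [sub_self] at this
      exact this.mono_left nhdsWithin_le_nhds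
    · filter_upwards [self_mem_nhdsWithin] with r hr
      exact sub_pos.2 (mem_Ioi.1 hr)
  have h1 := hv.sub ((hS.tendsto w).comp h0)
  rw [sub_neg_eq_add] at h1
  have h2 : Tendsto (fun r : ℝ => t - r) (𝓝[>] s) (𝓝 (t - s)) :=
    (tendsto_id.const_sub t).mono_left nhdsWithin_le_nhds
  refine (hS.tendsto_apply h2 h1).congr' ?_
  filter_upwards [Ioo_mem_nhdsGT hst] with r hr
  have hr1 : 0 ≤ r - s := sub_nonneg.2 hr.1.le
  have hr2 : 0 ≤ t - r := sub_nonneg.2 hr.2.le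
  -- Splitting off the common factor S (t - r) leaves the slope of v minus the difference quotient
  -- of the semigroup at v s = R w, so only forward times occur.
  have e : S (t - s) (v s) = S (t - r) (S (r - s) (v s)) := by
    rw [← mul_apply_eq_comp, ← hS.map_add _ _ hr2 hr1]
    congr 2; ring
  simp only [slope_def_module, Function.comp]
  rw [e, ← hw, ← smul_sub, map_smul, ← map_sub]
  congr 2
  abel

end IsContractionSemigroup

lemma IsC0Semigroup.hasDerivWithinAt {S : ℝ → H →L[ℝ] H} (hS : IsC0Semigroup S) {x y : H}
    (h : Tendsto (fun h : ℝ => h⁻¹ • (S h x - x)) (𝓝[>] 0) (𝓝 y)) {s : ℝ} (hs : 0 ≤ s) :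
    HasDerivWithinAt (fun r => S r x) (S s y) (Ioi s) s := by
  rw [hasDerivWithinAt_iff_tendsto_slope' self_notMem_Ioi]
  have h0 : Tendsto (fun r : ℝ => r - s) (𝓝[>] s) (𝓝[>] 0) := by
    refine tendsto_nhdsWithin_iff.2 ⟨?_, ?_⟩
    · have : Tendsto (fun r : ℝ => r - s) (𝓝 s) (𝓝 (s - s)) := tendsto_id.sub_const s
      rw [sub_self] at this
      exact this.mono_left nhdsWithin_le_nhds
    · filter_upwards [self_mem_nhdsWithin] with r hr
      exact sub_pos.2 (mem_Ioi.1 hr)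
  refine (((S s).continuous.tendsto y).comp (h.comp h0)).congr' ?_
  filter_upwards [self_mem_nhdsWithin] with r hr
  have hr1 : 0 ≤ r - s := sub_nonneg.2 (le_of_lt hr)
  have e : S r x = S s (S (r - s) x) := by
    rw [← ContinuousLinearMap.comp_apply, ← hS.map_add _ _ hs hr1]
    congr 2; ring
  simp only [slope_def_module, Function.comp]
  rw [e, map_smul, map_sub]

/-- `R` is the bounded, symmetric and positive inverse of `B`. -/
structure IsBoundedInverse [CompleteSpace H] (B : H →ₗ.[ℝ] H) (R : H →L[ℝ] H) : Prop where
  isSelfAdjoint : IsSelfAdjoint R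
  inner_nonneg : ∀ x, 0 ≤ inner ℝ (R x) x
  mem : ∀ y, R y ∈ B.domain
  apply_inverse : ∀ y, B ⟨R y, mem y⟩ = y
  inverse_apply : ∀ x : B.domain, R (B x) = x

variable [CompleteSpace H]

lemma inner_apply_comm {B : H →ₗ.[ℝ] H} (hB : IsSelfAdjoint B) (x y : B.domain) :
    inner ℝ (B x) (y : H) = inner ℝ (x : H) (B y) := by
  have h := LinearPMap.adjoint_isFormalAdjoint hB.dense_domain
  rw [LinearPMap.isSelfAdjoint_def.1 hB] at h
  exact h x y

/-- Coercivity bounds ‖x‖ by ‖B x‖, so B is injective and, its graph being closed, has closed range.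
A vector orthogonal to the range lies in the domain of the adjoint, which is B, and coercivity kills
it. The inverse is symmetric and everywhere defined, hence bounded by Hellinger–Toeplitz. -/
theorem exists_isBoundedInverse {B : H →ₗ.[ℝ] H} (hB : IsSelfAdjoint B)
    (hpos : StrictlyPositive B) : ∃ R, IsBoundedInverse B R := by
  obtain ⟨Λ, hΛ, hc⟩ := hpos
  have hbound : ∀ x : B.domain, ‖(x : H)‖ ≤ Λ⁻¹ * ‖B x‖ := by
    intro x
    rw [le_inv_mul_iff₀ hΛ]
    rcases (norm_nonneg (x : H)).eq_or_lt with h | h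
    · rw [← h]; simp
    · have h1 := (hc x).trans (real_inner_le_norm _ _)
      rw [pow_two, ← mul_assoc] at h1
      exact le_of_mul_le_mul_right h1 h
  have hinj : Function.Injective B.toFun := by
    rw [injective_iff_map_eq_zero]
    intro x hx
    have := hbound x
    rw [show B x = 0 from hx] at this
    simp only [norm_zero, mul_zero] at this
    exact Subtype.ext (norm_le_zero_iff.1 this)
  have hclosed : IsClosed (LinearMap.range B.toFun : Set H) := by
    let f : B.graph →L[ℝ] H := (ContinuousLinearMap.snd ℝ H H).comp B.graph.subtypeL
    have : CompleteSpace B.graph := (show IsClosed (B.graph : Set (H × H)) from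
      hB.isClosed).completeSpace_coe
    have hanti : AntilipschitzWith (max Λ⁻¹ 1).toNNReal f := by
      refine AddMonoidHomClass.antilipschitz_of_bound f fun p => ?_
      obtain ⟨⟨x, y⟩, hp⟩ := p
      obtain ⟨z, hz1, hz2⟩ := (LinearPMap.mem_graph_iff B).1 hp
      simp only at hz1 hz2
      subst hz1 hz2
      rw [Real.coe_toNNReal _ (by positivity)]
      change max ‖(z : H)‖ ‖B z‖ ≤ max Λ⁻¹ 1 * ‖B z‖
      refine max_le ((hbound z).trans ?_) ?_
      · gcongr; exact le_max_left _ _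
      · exact le_mul_of_one_le_left (norm_nonneg _) (le_max_right _ _)
    have h := hanti.isClosed_range f.uniformContinuous
    convert! h using 1
    ext y
    constructor
    · rintro ⟨x, rfl⟩
      exact ⟨⟨((x : H), B x), B.mem_graph x⟩, rfl⟩
    · rintro ⟨⟨⟨x, y'⟩, hp⟩, rfl⟩
      obtain ⟨z, -, hz2⟩ := (LinearPMap.mem_graph_iff B).1 hp
      exact ⟨z, hz2⟩
  have hperp : (LinearMap.range B.toFun)ᗮ = ⊥ := by
    rw [Submodule.eq_bot_iff]
    intro y hy
    rw [Submodule.mem_orthogonal] at hy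
    have hy' : ∀ x : B.domain, inner ℝ (B x) y = 0 := fun x => hy _ ⟨x, rfl⟩
    have hd : y ∈ B.adjoint.domain := LinearPMap.mem_adjoint_domain_of_exists y
      ⟨0, fun x => by rw [inner_zero_left, real_inner_comm]; exact (hy' x).symm⟩
    rw [LinearPMap.isSelfAdjoint_def.1 hB] at hd
    have h1 := hc ⟨y, hd⟩
    rw [hy'] at h1
    have h2 : ‖y‖ ^ 2 ≤ 0 := by
      by_contra h
      push Not at h
      exact absurd h1 (not_le.2 (mul_pos hΛ h))
    exact norm_eq_zero.1 (pow_eq_zero_iff two_ne_zero |>.1 (le_antisymm h2 (sq_nonneg _)))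
  have hsurj : Function.Surjective B.toFun := by
    rw [← LinearMap.range_eq_top]
    have : CompleteSpace (LinearMap.range B.toFun) := hclosed.completeSpace_coe
    exact (Submodule.orthogonal_eq_bot_iff).1 hperp
  let e := LinearEquiv.ofBijective B.toFun ⟨hinj, hsurj⟩
  let r : H →ₗ[ℝ] H := B.domain.subtype.comp e.symm.toLinearMap
  have hr : ∀ y, B (e.symm y) = y := fun y => e.apply_symm_apply y
  have hsym : r.IsSymmetric := fun y z => by
    have h := inner_apply_comm hB (e.symm y) (e.symm z)
    rw [hr, hr] at h
    exact h.symm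
  let R : H →L[ℝ] H := ⟨r, hsym.continuous⟩
  refine ⟨R, ?_, fun x => ?_, fun y => (e.symm y).2, hr, fun x => ?_⟩
  · exact ContinuousLinearMap.isSelfAdjoint_iff_isSymmetric.2 hsym
  · have h := hc (e.symm x)
    rw [hr, real_inner_comm] at h
    exact le_trans (by positivity) h
  · exact congrArg Subtype.val (e.symm_apply_apply x)

namespace IsBoundedInverse

variable {B : H →ₗ.[ℝ] H} {R : H →L[ℝ] H} (hR : IsBoundedInverse B R)
include hR

lemma injective : Function.Injective R := by
  intro x y hxy
  rw [← hR.apply_inverse x, ← hR.apply_inverse y]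
  congr 1
  exact Subtype.ext hxy

lemma denseRange : DenseRange R := denseRange_of_injective hR.isSelfAdjoint hR.injective

lemma mem_graph_neg_iff (x y : H) : (x, y) ∈ (-B).graph ↔ x = R (-y) := by
  rw [LinearPMap.mem_graph_iff]
  constructor
  · rintro ⟨z, hz1, hz2⟩
    simp only at hz1 hz2
    rw [← hz1, ← hz2, LinearPMap.neg_apply, neg_neg]
    exact (hR.inverse_apply z).symm
  · rintro rfl
    refine ⟨⟨R (-y), hR.mem _⟩, rfl, ?_⟩
    rw [LinearPMap.neg_apply]
    exact (congrArg Neg.neg (hR.apply_inverse (-y))).trans (neg_neg y)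

end IsBoundedInverse

/-- `expNeg` is defined by choice, so uniqueness is needed: for a second semigroup S' with the same
generator, r ↦ S (t - r) S' r (R y) has vanishing right derivative, hence equal values at 0 and t.
-/
theorem expNeg_eq {B : H →ₗ.[ℝ] H} {R : H →L[ℝ] H} (hR : IsBoundedInverse B R)
    {S : ℝ → H →L[ℝ] H} (hS : IsContractionSemigroup R S) {t : ℝ} (ht : 0 ≤ t) :
    expNeg B t = S t := by
  have hex : ∃ S : ℝ → H →L[ℝ] H, IsC0Semigroup S ∧ HasGenerator S (-B) := by
    refine ⟨S, hS.isC0Semigroup, fun x y => ?_⟩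
    rw [hR.mem_graph_neg_iff]
    constructor
    · rintro rfl
      simpa using hS.tendsto (-y)
    -- Applying R to the convergent quotients and comparing with `hS.tendsto x` shows x = R (-y), so
    -- the generator has no larger domain than B.
    · intro h
      have h1 := (R.continuous.tendsto y).comp h
      have h2 : Tendsto (fun h : ℝ => h⁻¹ • (S h (R x) - R x)) (𝓝[>] 0) (𝓝 (R y)) := by
        refine h1.congr fun r => ?_
        simp only [Function.comp]
        rw [map_smul, map_sub, hS.apply_inverse_comm]
      have h3 := tendsto_nhds_unique h2 (hS.tendsto x)
      rw [map_neg, h3, neg_neg]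
  obtain ⟨hc, hg⟩ := hex.choose_spec
  set S' := hex.choose with hS'
  have e : expNeg B t = S' t := by
    rw [expNeg, semigroup, dif_pos hex]
  rw [e]
  have hgR : ∀ y, Tendsto (fun h : ℝ => h⁻¹ • (S' h (R y) - R y)) (𝓝[>] 0) (𝓝 (-y)) := fun y =>
    (hg _ _).1 ((hR.mem_graph_neg_iff _ _).2 (by rw [neg_neg]))
  have hcomm : ∀ s, 0 ≤ s → ∀ y, S' s (R y) = R (S' s y) := by
    intro s hs y
    have h1 := ((S' s).continuous.tendsto _).comp (hgR y)
    have h2 : Tendsto (fun h : ℝ => h⁻¹ • (S' h (S' s (R y)) - S' s (R y))) (𝓝[>] 0)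
        (𝓝 (S' s (-y))) := by
      refine h1.congr' ?_
      filter_upwards [self_mem_nhdsWithin] with h hh
      have hh0 : (0 : ℝ) ≤ h := le_of_lt hh
      simp only [Function.comp]
      have e : S' s (S' h (R y)) = S' h (S' s (R y)) := by
        rw [← ContinuousLinearMap.comp_apply (S' s), ← ContinuousLinearMap.comp_apply (S' h),
          ← hc.map_add _ _ hs hh0, ← hc.map_add _ _ hh0 hs, add_comm]
      rw [map_smul, map_sub, e]
    have h3 := (hR.mem_graph_neg_iff _ _).1 ((hg _ _).2 h2)
    rw [h3, map_neg (S' s), neg_neg]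
  have key : ∀ y, S' t (R y) = S t (R y) := by
    intro y
    have hcont : ContinuousOn (fun r => S (t - r) (S' r (R y))) (Icc 0 t) := by
      intro r hr
      refine hS.tendsto_apply ?_ ((hc.continuousOn (R y)).mono Icc_subset_Ici_self r hr)
      exact (tendsto_id.const_sub t).mono_left nhdsWithin_le_nhds
    have h := constant_of_has_deriv_right_zero hcont (fun s hs => ?_) t ⟨ht, le_rfl⟩
    · have h0 : S' 0 (R y) = R y := by rw [hc.map_zero]; rfl
      simpa [hS.map_zero, h0] using h
    · have hd := hS.hasDerivWithinAt_sub (t := t) hs.2 (hc.hasDerivWithinAt (hgR y) hs.1)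
        (hcomm s hs.1 y)
      rw [map_neg, neg_add_cancel, map_zero] at hd
      exact (hasDerivWithinAt_Ioi_iff_Ici).1 hd
  refine ContinuousLinearMap.ext fun x => ?_
  exact congrFun (hR.denseRange.equalizer (S' t).continuous (S t).continuous (funext key)) x

end Generator

/-! ### The commuting family of semigroups -/

section Family

variable {H : Type*} [NormedAddCommGroup H] [InnerProductSpace ℝ H]

lemma IsContractionSemigroup.inner_eq_norm_sq {R : H →L[ℝ] H} {S : ℝ → H →L[ℝ] H}
    (hS : IsContractionSemigroup R S) {t : ℝ} (ht : 0 ≤ t) (x : H) :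
    inner ℝ x (S (2 * t) x) = ‖S t x‖ ^ 2 := by
  rw [two_mul, hS.map_add t t ht ht, mul_apply_eq_comp, ← hS.symm, real_inner_self_eq_norm_sq]

/-- Since ‖S s x‖² = ⟨x, S (2s) x⟩, vanishing at time 2s forces vanishing at time s. Halve
repeatedly and use continuity at 0. -/
lemma IsContractionSemigroup.eq_zero_of_apply_eq_zero {R : H →L[ℝ] H} {S : ℝ → H →L[ℝ] H}
    (hS : IsContractionSemigroup R S) {t : ℝ} (ht : 0 ≤ t) {x : H} (hx : S t x = 0) : x = 0 := by
  have h1 : ∀ k : ℕ, S (t * (1 / 2) ^ k) x = 0 := by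
    intro k
    induction k with
    | zero => simpa using hx
    | succ k ih =>
      have h := hS.inner_eq_norm_sq (t := t * (1 / 2) ^ (k + 1)) (by positivity) x
      rw [show 2 * (t * (1 / 2) ^ (k + 1)) = t * (1 / 2) ^ k by ring, ih, inner_zero_right] at h
      exact norm_eq_zero.1 (pow_eq_zero_iff two_ne_zero |>.1 h.symm)
  have h2 : Tendsto (fun k : ℕ => t * (1 / 2 : ℝ) ^ k) atTop (𝓝 0) := by
    simpa using (tendsto_pow_atTop_nhds_zero_of_lt_one (by norm_num)
      (by norm_num : (1 / 2 : ℝ) < 1)).const_mul t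
  have h3 := ((hS.continuous x).tendsto 0).comp h2
  have h4 : Tendsto (fun _ : ℕ => (0 : H)) atTop (𝓝 (S 0 x)) := h3.congr h1
  rw [hS.map_zero] at h4
  exact tendsto_nhds_unique h4 tendsto_const_nhds

variable {n : ℕ}

/-- The operator `∑ i, l i • A i` on the common domain. -/
noncomputable def combOn (A : Fin n → H →ₗ.[ℝ] H) (l : EuclideanSpace ℝ (Fin n)) :
    commonDomain A →ₗ[ℝ] H := ∑ i, l i • onCommon A i

lemma combOn_apply (A : Fin n → H →ₗ.[ℝ] H) (l : EuclideanSpace ℝ (Fin n))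
    (x : commonDomain A) : combOn A l x = ∑ i, l i • onCommon A i x := by
  simp [combOn]

lemma combOn_sub (A : Fin n → H →ₗ.[ℝ] H) (l m : EuclideanSpace ℝ (Fin n))
    (x : commonDomain A) : combOn A (m - l) x = combOn A m x - combOn A l x := by
  simp [combOn_apply, sub_smul]

lemma strictlyPositive_combination {A : Fin n → H →ₗ.[ℝ] H}
    (hA : ∀ i, StrictlyPositive (A i)) (i₀ : Fin n) {l : EuclideanSpace ℝ (Fin n)}
    (hl : l ∈ posOrthant n) : StrictlyPositive (combination A l) := by
  choose Λ hΛ hΛA using hA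
  have hΛA' : ∀ i (x : commonDomain A),
      Λ i * ‖(x : H)‖ ^ 2 ≤ inner ℝ (onCommon A i x) (x : H) := fun i x =>
    hΛA i (Submodule.inclusion (iInf_le (fun j => (A j).domain) i) x)
  suffices h : ∀ x : commonDomain A,
      l i₀ * Λ i₀ * ‖(x : H)‖ ^ 2 ≤ inner ℝ (combOn A l x) (x : H) from
    ⟨l i₀ * Λ i₀, mul_pos (hl i₀) (hΛ i₀), h⟩
  intro x
  rw [combOn_apply, sum_inner]
  refine le_trans ?_ (Finset.single_le_sum (f := fun i => inner ℝ (l i • onCommon A i x) (x : H))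
    (fun i _ => ?_) (Finset.mem_univ i₀))
  · simp only
    rw [real_inner_smul_left, mul_assoc]
    exact mul_le_mul_of_nonneg_left (hΛA' i₀ x) (hl i₀).le
  · rw [real_inner_smul_left]
    exact mul_nonneg (hl i).le (le_trans (mul_nonneg (hΛ i).le (sq_nonneg _)) (hΛA' i x))

variable [CompleteSpace H]

/-- `S l` is the semigroup generated by `-A(l)`, and `R l` is the inverse of `A(l)`. -/
structure IsSemigroupFamily (A : Fin n → H →ₗ.[ℝ] H) (R : EuclideanSpace ℝ (Fin n) → H →L[ℝ] H)
    (S : EuclideanSpace ℝ (Fin n) → ℝ → H →L[ℝ] H) : Prop where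
  symm : ∀ i (x y : commonDomain A),
    inner ℝ (onCommon A i x) (y : H) = inner ℝ (x : H) (onCommon A i y)
  comm : CommuteOnCommon A
  inverse : ∀ l ∈ posOrthant n, IsBoundedInverse (combination A l) (R l)
  semigroup : ∀ l ∈ posOrthant n, IsContractionSemigroup (R l) (S l)

theorem exists_isSemigroupFamily {A : Fin n → H →ₗ.[ℝ] H}
    (hA_selfAdjoint : ∀ i, IsSelfAdjoint (A i)) (hA_pos : ∀ i, StrictlyPositive (A i))
    (hA_comm : CommuteOnCommon A)
    (hA_comb : ∀ l ∈ posOrthant n, IsSelfAdjoint (combination A l)) (i₀ : Fin n) :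
    ∃ R S, IsSemigroupFamily A R S := by
  have h : ∀ l : EuclideanSpace ℝ (Fin n), ∃ R : H →L[ℝ] H, ∃ S : ℝ → H →L[ℝ] H,
      l ∈ posOrthant n → IsBoundedInverse (combination A l) R ∧ IsContractionSemigroup R S := by
    intro l
    by_cases hl : l ∈ posOrthant n
    · obtain ⟨R, hR⟩ := exists_isBoundedInverse (hA_comb l hl)
        (strictlyPositive_combination hA_pos i₀ hl)
      obtain ⟨S, hS⟩ := exists_isContractionSemigroup hR.isSelfAdjoint hR.inner_nonneg hR.injective
      exact ⟨R, S, fun _ => ⟨hR, hS⟩⟩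
    · exact ⟨0, 0, fun h => absurd h hl⟩
  choose R S hRS using h
  exact ⟨R, S, fun i x y => inner_apply_comm (hA_selfAdjoint i)
      (Submodule.inclusion (iInf_le (fun j => (A j).domain) i) x)
      (Submodule.inclusion (iInf_le (fun j => (A j).domain) i) y), hA_comm,
    fun l hl => (hRS l hl).1, fun l hl => (hRS l hl).2⟩

namespace IsSemigroupFamily

variable {A : Fin n → H →ₗ.[ℝ] H} {R : EuclideanSpace ℝ (Fin n) → H →L[ℝ] H}
  {S : EuclideanSpace ℝ (Fin n) → ℝ → H →L[ℝ] H} (hF : IsSemigroupFamily A R S)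
include hF

/-! ### Commutation of the operators with the inverses and the semigroups. -/

lemma combOn_comm (l : EuclideanSpace ℝ (Fin n)) (i : Fin n) (x y : commonDomain A) :
    inner ℝ (onCommon A i x) (combOn A l y) = inner ℝ (combOn A l x) (onCommon A i y) := by
  rw [combOn_apply, combOn_apply, sum_inner, inner_sum]
  refine Finset.sum_congr rfl fun j _ => ?_
  rw [real_inner_smul_left, real_inner_smul_right, hF.comm]

variable {l m : EuclideanSpace ℝ (Fin n)}

/-- `A(l)⁻¹ y` as an element of the common domain. -/
lemma inverse_mem (hl : l ∈ posOrthant n) (y : H) : R l y ∈ commonDomain A :=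
  (hF.inverse l hl).mem y

lemma combOn_inverse (hl : l ∈ posOrthant n) (y : H) :
    combOn A l ⟨R l y, hF.inverse_mem hl y⟩ = y := (hF.inverse l hl).apply_inverse y

lemma inverse_combOn (hl : l ∈ posOrthant n) (x : commonDomain A) :
    R l (combOn A l x) = x := (hF.inverse l hl).inverse_apply x

lemma inner_inverse (hl : l ∈ posOrthant n) (x y : H) :
    inner ℝ (R l x) y = inner ℝ x (R l y) :=
  ContinuousLinearMap.isSelfAdjoint_iff_isSymmetric.1 (hF.inverse l hl).isSelfAdjoint x y

/-- Writing y = A(l)R y lets the form commutation on D exchange `A i` and A(l), without applying any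
product of unbounded operators. -/
lemma inner_onCommon_inverse (hl : l ∈ posOrthant n) (i : Fin n) (x : commonDomain A) (y : H) :
    inner ℝ (onCommon A i ⟨R l x, hF.inverse_mem hl x⟩) y
      = inner ℝ (x : H) (onCommon A i ⟨R l y, hF.inverse_mem hl y⟩) := by
  conv_lhs => rw [← hF.combOn_inverse hl y]
  rw [hF.combOn_comm, hF.combOn_inverse hl]

lemma onCommon_inverse (hl : l ∈ posOrthant n) (i : Fin n) (x : commonDomain A) :
    onCommon A i ⟨R l x, hF.inverse_mem hl x⟩ = R l (onCommon A i x) := by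
  refine ext_inner_right ℝ fun y => ?_
  rw [hF.inner_onCommon_inverse hl, hF.inner_inverse hl, hF.symm i x ⟨R l y, hF.inverse_mem hl y⟩]

lemma combOn_inverse_comm (hl : l ∈ posOrthant n) (δ : EuclideanSpace ℝ (Fin n))
    (x : commonDomain A) :
    combOn A δ ⟨R l x, hF.inverse_mem hl x⟩ = R l (combOn A δ x) := by
  simp_rw [combOn_apply, hF.onCommon_inverse hl, map_sum, map_smul]

lemma commute_inverse (hl : l ∈ posOrthant n) (hm : m ∈ posOrthant n) :
    Commute (R l) (R m) := by
  refine ContinuousLinearMap.ext fun w => ?_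
  simp only [mul_apply_eq_comp]
  have h := hF.combOn_inverse_comm hl m ⟨R m w, hF.inverse_mem hm w⟩
  rw [hF.combOn_inverse hm] at h
  rw [← h, hF.inverse_combOn hm]

lemma commute_semigroup_inverse (hl : l ∈ posOrthant n) (hm : m ∈ posOrthant n) (t : ℝ) :
    Commute (R m) (S l t) :=
  (hF.semigroup l hl).commute _ (hF.commute_inverse hm hl) t

lemma commute_semigroup (hl : l ∈ posOrthant n) (hm : m ∈ posOrthant n) (t s : ℝ) :
    Commute (S l t) (S m s) :=
  (hF.semigroup m hm).commute _ (hF.commute_semigroup_inverse hl hm t).symm s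

lemma semigroup_comm (hl : l ∈ posOrthant n) (hm : m ∈ posOrthant n) (t s : ℝ) (x : H) :
    S l t (S m s x) = S m s (S l t x) :=
  DFunLike.congr_fun (hF.commute_semigroup hl hm t s).eq x

lemma semigroup_mem (hl : l ∈ posOrthant n) (t : ℝ) (x : commonDomain A) :
    S l t x ∈ commonDomain A := by
  rw [← hF.inverse_combOn hl x, (hF.semigroup l hl).apply_inverse_comm]
  exact hF.inverse_mem hl _

/-- The operator `A i A(l)⁻¹` as a bounded operator; it commutes with `A(l)⁻¹`. -/
lemma exists_onCommon_comp_inverse (hl : l ∈ posOrthant n) (i : Fin n) :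
    ∃ K : H →L[ℝ] H, (∀ y, K y = onCommon A i ⟨R l y, hF.inverse_mem hl y⟩) ∧
      Commute K (R l) := by
  let r : H →ₗ[ℝ] H :=
    (onCommon A i).comp ((R l).toLinearMap.codRestrict (commonDomain A) (hF.inverse_mem hl))
  have hr : ∀ y, r y = onCommon A i ⟨R l y, hF.inverse_mem hl y⟩ := fun y => rfl
  have hrc : ∀ y, r (R l y) = R l (r y) := fun y => by
    rw [hr, hr]; exact hF.onCommon_inverse hl i ⟨R l y, hF.inverse_mem hl y⟩
  have hsym : r.IsSymmetric := by
    intro x y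
    have h1 : inner ℝ (r x) y = inner ℝ (onCommon A i ⟨R l x, hF.inverse_mem hl x⟩)
      (combOn A l ⟨R l y, hF.inverse_mem hl y⟩) := by rw [hF.combOn_inverse hl, hr]
    rw [h1, hF.combOn_comm, hF.combOn_inverse hl, hr]
  refine ⟨⟨r, hsym.continuous⟩, hr, ContinuousLinearMap.ext hrc⟩

/-- On D, `A i` = K A(l) with K = `A i` A(l)⁻¹ bounded. K commutes with A(l)⁻¹, and therefore with
the semigroup. -/
lemma onCommon_semigroup (hl : l ∈ posOrthant n) (i : Fin n) (t : ℝ) (x : commonDomain A) :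
    onCommon A i ⟨S l t x, hF.semigroup_mem hl t x⟩ = S l t (onCommon A i x) := by
  obtain ⟨K, hK, hKR⟩ := hF.exists_onCommon_comp_inverse hl i
  have hKx : ∀ z : commonDomain A, K (combOn A l z) = onCommon A i z := fun z => by
    rw [hK]; congr 1; exact Subtype.ext (hF.inverse_combOn hl z)
  have hKS : ∀ y, K (S l t y) = S l t (K y) := fun y =>
    DFunLike.congr_fun ((hF.semigroup l hl).commute K hKR t).eq y
  rw [← hKx x, ← hKS, hK]
  congr 1
  refine Subtype.ext ?_
  simp only
  rw [← (hF.semigroup l hl).apply_inverse_comm, hF.inverse_combOn hl]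

lemma combOn_semigroup (hl : l ∈ posOrthant n) (δ : EuclideanSpace ℝ (Fin n)) (t : ℝ)
    (x : commonDomain A) :
    combOn A δ ⟨S l t x, hF.semigroup_mem hl t x⟩ = S l t (combOn A δ x) := by
  simp_rw [combOn_apply, hF.onCommon_semigroup hl, map_sum, map_smul]

lemma energy_eq (hl : l ∈ posOrthant n) (i : Fin n) {t : ℝ} (ht : 0 ≤ t) (u : commonDomain A) :
    energy A (u : H) i l t = inner ℝ (onCommon A i u) (S l (2 * t) u) := by
  have hS := hF.semigroup l hl
  rw [energy, expNeg_eq (hF.inverse l hl) hS ht]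
  have h1 : app (A i) (S l t u) = onCommon A i ⟨S l t u, hF.semigroup_mem hl t u⟩ := by
    have : S l t u ∈ (A i).domain :=
      (iInf_le (fun j => (A j).domain) i) (hF.semigroup_mem hl t u)
    rw [app, dif_pos this]
    rfl
  rw [h1, hF.onCommon_semigroup hl, hS.symm, two_mul, hS.map_add t t ht ht, mul_apply_eq_comp]

/-! ### Duhamel's formula and convexity in l. -/

lemma continuous_mixed (hl : l ∈ posOrthant n) (hm : m ∈ posOrthant n) (t : ℝ) (x : H) :
    Continuous fun s => S l (t - s) (S m s x) :=
  (hF.semigroup l hl).continuous_apply (continuous_const.sub continuous_id)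
    ((hF.semigroup m hm).continuous x)

/-- Duhamel's formula. -/
lemma duhamel (hl : l ∈ posOrthant n) (hm : m ∈ posOrthant n) {s t : ℝ} (hs : 0 ≤ s)
    (hst : s ≤ t) (x : commonDomain A) :
    S l (t - s) (S m s x) - S l t x
      = -∫ r in (0 : ℝ)..s, S l (t - r) (S m r (combOn A (m - l) x)) := by
  have hSl := hF.semigroup l hl
  have hSm := hF.semigroup m hm
  have hcont := hF.continuous_mixed hl hm t
  have hd : ∀ r ∈ Ioo 0 s, HasDerivWithinAt (fun r => S l (t - r) (S m r x))
      (-(S l (t - r) (S m r (combOn A (m - l) x)))) (Ioi r) r := by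
    intro r hr
    have h1 := hSm.isC0Semigroup.hasDerivWithinAt (hSm.tendsto (combOn A m x)) hr.1.le
    rw [hF.inverse_combOn hm] at h1
    have h2 : S m r x = R l (S m r (combOn A l x)) := by
      rw [← hF.combOn_semigroup hm, hF.inverse_combOn hl]
    have h3 := hSl.hasDerivWithinAt_sub (lt_of_lt_of_le hr.2 hst) h1 h2
    refine h3.congr_deriv ?_
    rw [combOn_sub, map_neg, ← map_neg (S l (t - r))]
    congr 1
    rw [map_sub]
    abel
  have h := intervalIntegral.integral_eq_sub_of_hasDeriv_right_of_le hs (hcont x).continuousOn hd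
    (hcont _).neg.continuousOn.intervalIntegrable
  rw [intervalIntegral.integral_neg] at h
  rw [h, sub_zero, hSm.map_zero]
  simp

lemma norm_semigroup_sub_le (hl : l ∈ posOrthant n) (hm : m ∈ posOrthant n) {t : ℝ} (ht : 0 ≤ t)
    (x : commonDomain A) : ‖S m t x - S l t x‖ ≤ t * ‖combOn A (m - l) x‖ := by
  have h := hF.duhamel hl hm ht le_rfl x
  rw [sub_self, (hF.semigroup l hl).map_zero, one_apply_eq_self] at h
  rw [h, norm_neg]
  have := intervalIntegral.norm_integral_le_of_norm_le_const (a := 0) (b := t)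
    (f := fun r => S l (t - r) (S m r (combOn A (m - l) x))) (C := ‖combOn A (m - l) x‖)
    fun r _ => ((hF.semigroup l hl).norm_le _ _).trans ((hF.semigroup m hm).norm_le _ _)
  rwa [sub_zero, abs_of_nonneg ht, mul_comm] at this

/-- The commuting symmetric factors each have a square root, namely the semigroup at half the time.
-/
lemma inner_mixed_eq (hl : l ∈ posOrthant n) (hm : m ∈ posOrthant n) {r t : ℝ} (hr : 0 ≤ r)
    (hrt : r ≤ t) (w : H) :
    inner ℝ w (S l (t - r) (S m r w)) = ‖S l ((t - r) / 2) (S m (r / 2) w)‖ ^ 2 := by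
  have hSl := hF.semigroup l hl
  have hSm := hF.semigroup m hm
  have h1 : S l (t - r) = S l ((t - r) / 2) * S l ((t - r) / 2) := by
    rw [← hSl.map_add _ _ (by linarith) (by linarith), add_halves]
  have h2 : S m r = S m (r / 2) * S m (r / 2) := by
    rw [← hSm.map_add _ _ (by linarith) (by linarith), add_halves]
  rw [h1, h2]
  simp only [mul_apply_eq_comp]
  rw [← hSl.symm, hF.semigroup_comm hl hm _ (r / 2), ← hSm.symm, ← hF.semigroup_comm hl hm,
    real_inner_self_eq_norm_sq]

/-- Along the segment from `l` to `m` the gradient of `l ↦ ⟨u, e^{-tA(l)} u⟩` is strictly monotone. -/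
lemma inner_combOn_le (hl : l ∈ posOrthant n) (hm : m ∈ posOrthant n) {s t : ℝ} (hs : 0 ≤ s)
    (hst : s ≤ t) (u : commonDomain A) :
    inner ℝ (combOn A (m - l) u) (S l (t - s) (S m s u))
        ≤ inner ℝ (combOn A (m - l) u) (S l t u) ∧
      (0 < s → combOn A (m - l) u ≠ 0 →
        inner ℝ (combOn A (m - l) u) (S l (t - s) (S m s u))
          < inner ℝ (combOn A (m - l) u) (S l t u)) := by
  set w := combOn A (m - l) u with hw
  have hcont := hF.continuous_mixed hl hm t w
  have h := hF.duhamel hl hm hs hst u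
  rw [← hw] at h
  have h1 : inner ℝ w (S l (t - s) (S m s u)) - inner ℝ w (S l t u)
      = -∫ r in (0 : ℝ)..s, inner ℝ w (S l (t - r) (S m r w)) := by
    rw [← inner_sub_right, h, inner_neg_right]
    congr 1
    exact ((innerSL ℝ w).intervalIntegral_comp_comm (hcont.intervalIntegrable 0 s)).symm
  have hnn : ∀ r ∈ Icc 0 s, 0 ≤ inner ℝ w (S l (t - r) (S m r w)) := fun r hr => by
    rw [hF.inner_mixed_eq hl hm hr.1 (hr.2.trans hst)]
    positivity
  constructor
  · have := intervalIntegral.integral_nonneg (μ := volume) hs hnn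
    linarith
  · intro hs0 hw0
    -- The integrand is a squared norm, and injectivity of both semigroups keeps it nonzero when w ≠
    -- 0.
    have : 0 < ∫ r in (0 : ℝ)..s, inner ℝ w (S l (t - r) (S m r w)) := by
      refine intervalIntegral.intervalIntegral_pos_of_pos_on
        ((continuous_const.inner hcont).intervalIntegrable 0 s) (fun r hr => ?_) hs0
      rw [hF.inner_mixed_eq hl hm hr.1.le (hr.2.le.trans hst)]
      refine pow_pos (norm_pos_iff.2 fun h0 => hw0 ?_) 2
      exact (hF.semigroup m hm).eq_zero_of_apply_eq_zero (by linarith [hr.1])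
        ((hF.semigroup l hl).eq_zero_of_apply_eq_zero (by linarith [hr.2]) h0)
    linarith

/-- Convexity of `l ↦ ⟨u, e^{-tA(l)} u⟩`. -/
lemma inner_semigroup_sub_ge (hl : l ∈ posOrthant n) (hm : m ∈ posOrthant n) {t : ℝ} (ht : 0 ≤ t)
    (u : commonDomain A) :
    -(t * inner ℝ (combOn A (m - l) u) (S l t u))
      ≤ inner ℝ (u : H) (S m t u) - inner ℝ (u : H) (S l t u) := by
  set w := combOn A (m - l) u with hw
  have hcont := hF.continuous_mixed hl hm t w
  have h := hF.duhamel hl hm ht le_rfl u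
  rw [sub_self, (hF.semigroup l hl).map_zero, one_apply_eq_self, ← hw] at h
  have h1 : inner ℝ (u : H) (S m t u) - inner ℝ (u : H) (S l t u)
      = -∫ r in (0 : ℝ)..t, inner ℝ (u : H) (S l (t - r) (S m r w)) := by
    rw [← inner_sub_right, h, inner_neg_right]
    congr 1
    exact ((innerSL ℝ (u : H)).intervalIntegral_comp_comm (hcont.intervalIntegrable 0 t)).symm
  rw [h1, neg_le_neg_iff]
  have h2 := intervalIntegral.integral_mono_on (a := 0) (b := t)
    (f := fun r => inner ℝ (u : H) (S l (t - r) (S m r w)))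
    (g := fun _ => inner ℝ w (S l t u)) (μ := volume) ht
    ((continuous_const.inner hcont).intervalIntegrable 0 t)
    (continuous_const.intervalIntegrable 0 t) fun r hr => ?_
  · simpa using h2
  -- By symmetry the integrand is ⟨w, S l (t - r) S m r u⟩, which the monotonicity at the
  -- intermediate time r bounds by its value at r = 0.
  · refine le_trans (le_of_eq ?_) (hF.inner_combOn_le hl hm hr.1 hr.2 u).1
    rw [← (hF.semigroup l hl).symm, ← (hF.semigroup m hm).symm, real_inner_comm,
      hF.semigroup_comm hl hm]

/-- This linear bound in t keeps the potential, which carries a factor 1/t, bounded near t = 0. -/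
lemma abs_inner_semigroup_sub_le (hl : l ∈ posOrthant n) {t : ℝ} (ht : 0 ≤ t)
    (u : commonDomain A) :
    |inner ℝ (u : H) (S l t u) - ‖(u : H)‖ ^ 2| ≤ t * (‖(u : H)‖ * ‖combOn A l u‖) := by
  have h := (hF.semigroup l hl).norm_sub_le t ht (combOn A l u)
  rw [hF.inverse_combOn hl] at h
  rw [← real_inner_self_eq_norm_sq, ← inner_sub_right]
  refine (abs_real_inner_le_norm _ _).trans ?_
  calc _ ≤ ‖(u : H)‖ * (t * ‖combOn A l u‖) := by gcongr
    _ = _ := by ring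

end IsSemigroupFamily

end Family

/-! ### Openness of the image of a strictly monotone gradient -/

section Gradient

variable {E : Type*} [NormedAddCommGroup E] [InnerProductSpace ℝ E]

/-- The inequality and its mirror image squeeze φ y - φ x between ⟨G x, y - x⟩ and ⟨G y, y - x⟩. -/
lemma continuousOn_of_subgradient {U : Set E} {φ : E → ℝ} {G : E → E} (hG : ContinuousOn G U)
    (hsub : ∀ x ∈ U, ∀ y ∈ U, inner ℝ (G x) (y - x) ≤ φ y - φ x) : ContinuousOn φ U := by
  intro x hx
  have h0 : Tendsto (fun y => y - x) (𝓝[U] x) (𝓝 0) := by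
    have : Tendsto (fun y => y - x) (𝓝 x) (𝓝 (x - x)) := tendsto_id.sub_const x
    rw [sub_self] at this
    exact this.mono_left nhdsWithin_le_nhds
  have h1 : Tendsto (fun y => inner ℝ (G x) (y - x)) (𝓝[U] x) (𝓝 0) := by
    simpa using (tendsto_const_nhds (x := G x)).inner (𝕜 := ℝ) h0
  have h2 : Tendsto (fun y => inner ℝ (G y) (y - x)) (𝓝[U] x) (𝓝 0) := by
    simpa using (hG x hx).tendsto.inner (𝕜 := ℝ) h0
  have h3 : Tendsto (fun y => φ y - φ x) (𝓝[U] x) (𝓝 0) := by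
    refine tendsto_of_tendsto_of_tendsto_of_le_of_le' h1 h2 ?_ ?_
    · filter_upwards [self_mem_nhdsWithin] with y hy using hsub x hx y hy
    · filter_upwards [self_mem_nhdsWithin] with y hy
      have := hsub y hy x hx
      rw [← neg_sub y x, inner_neg_right] at this
      linarith
  have h4 := h3.add_const (φ x)
  simp only [sub_add_cancel, zero_add] at h4
  exact h4

/-- The image of an open set under a continuous, strictly monotone gradient field is open. -/
theorem isOpen_image_of_strictMono_gradient [ProperSpace E] {U : Set E} (hU : IsOpen U) {φ : E → ℝ}
    {G : E → E} (hG : ContinuousOn G U)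
    (hmono : ∀ x ∈ U, ∀ y ∈ U, x ≠ y → 0 < inner ℝ (G y - G x) (y - x))
    (hsub : ∀ x ∈ U, ∀ y ∈ U, inner ℝ (G x) (y - x) ≤ φ y - φ x) : IsOpen (G '' U) := by
  have hφ := continuousOn_of_subgradient hG hsub
  rw [isOpen_iff_mem_nhds]
  rintro _ ⟨x₀, hx₀, rfl⟩
  obtain ⟨r, hr, hrU⟩ := Metric.nhds_basis_closedBall.mem_iff.1 (hU.mem_nhds hx₀)
  have hsphU : Metric.sphere x₀ r ⊆ U := Metric.sphere_subset_closedBall.trans hrU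
  -- By compactness, strict monotonicity is uniform on the sphere; c / r is then an admissible
  -- radius around G x₀.
  obtain ⟨c, hc, hcs⟩ := (isCompact_sphere x₀ r).exists_forall_le'
    (f := fun x => inner ℝ (G x - G x₀) (x - x₀)) (a := 0)
    (((hG.mono hsphU).sub continuousOn_const).inner (continuousOn_id.sub continuousOn_const))
    fun x hx => hmono x₀ hx₀ x (hsphU hx) fun h => by
      rw [← h, Metric.mem_sphere, dist_self] at hx
      exact hr.ne hx
  refine Filter.mem_of_superset (Metric.ball_mem_nhds (G x₀) (div_pos hc hr)) fun y hy => ?_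
  rw [mem_ball_iff_norm, lt_div_iff₀ hr] at hy
  obtain ⟨x, hx, hmin⟩ := (isCompact_closedBall x₀ r).exists_isMinOn
    ⟨x₀, Metric.mem_closedBall_self hr.le⟩
    (f := fun x => φ x - inner ℝ y x)
    ((hφ.mono hrU).sub (continuousOn_const.inner continuousOn_id))
  -- First-order condition in feasible directions, without differentiating φ: the subgradient at x +
  -- θv bounds the increment of φ by θ⟨G (x + θv), v⟩, and θ → 0 uses continuity of G.
  have hdir : ∀ v : E, (∀ᶠ θ : ℝ in 𝓝[>] 0, x + θ • v ∈ Metric.closedBall x₀ r) →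
      0 ≤ inner ℝ (G x - y) v := by
    intro v hv
    have ht : Tendsto (fun θ : ℝ => x + θ • v) (𝓝[>] 0) (𝓝[U] x) := by
      refine tendsto_nhdsWithin_iff.2 ⟨?_, hv.mono fun θ hθ => hrU hθ⟩
      have : Continuous fun θ : ℝ => x + θ • v := by fun_prop
      have := (this.tendsto 0).mono_left (nhdsWithin_le_nhds (s := Ioi 0))
      simpa using this
    have hlim := (((hG x (hrU hx)).tendsto.comp ht).sub_const y).inner (𝕜 := ℝ)
      (tendsto_const_nhds (x := v))
    refine ge_of_tendsto hlim ?_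
    filter_upwards [hv, self_mem_nhdsWithin] with θ hθ hθ0
    have hθ0' : (0 : ℝ) < θ := hθ0
    have h1 := hmin hθ
    simp only [mem_ofPred_eq] at h1
    have h2 := hsub _ (hrU hθ) x (hrU hx)
    have e : x - (x + θ • v) = -(θ • v) := by abel
    rw [e, inner_neg_right, real_inner_smul_right] at h2
    rw [inner_add_right, real_inner_smul_right] at h1
    simp only [Function.comp]
    rw [inner_sub_left]
    have h3 : 0 ≤ θ * (inner ℝ (G (x + θ • v)) v - inner ℝ y v) := by linarith
    exact nonneg_of_mul_nonneg_right h3 hθ0'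
  rcases (Metric.mem_closedBall.1 hx).lt_or_eq with hlt | heq
  · refine ⟨x, hrU hx, ?_⟩
    have h := hdir (-(G x - y)) ?_
    · rw [inner_neg_right, real_inner_self_eq_norm_sq] at h
      have : ‖G x - y‖ = 0 := by nlinarith [norm_nonneg (G x - y)]
      exact sub_eq_zero.1 (norm_eq_zero.1 this)
    · have hcont : Continuous fun θ : ℝ => x + θ • (-(G x - y)) := by fun_prop
      have := (hcont.tendsto 0).mono_left (nhdsWithin_le_nhds (s := Ioi 0))
      rw [zero_smul, add_zero] at this
      exact this.eventually (Filter.mem_of_superset (Metric.isOpen_ball.mem_nhds hlt)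
        Metric.ball_subset_closedBall)
  -- At a boundary minimum the inward direction x₀ - x gives ⟨G x - y, x - x₀⟩ ≤ 0, whereas `hcs`
  -- and ‖y - G x₀‖ r < c make it positive.
  · exfalso
    have h := hdir (x₀ - x) ?_
    · have h1 := hcs x heq
      have h2 : inner ℝ (y - G x₀) (x - x₀) ≤ ‖y - G x₀‖ * r := by
        refine (real_inner_le_norm _ _).trans (le_of_eq ?_)
        rw [← dist_eq_norm x, heq]
      rw [← neg_sub x, inner_neg_right] at h
      have e : G x - G x₀ = (G x - y) + (y - G x₀) := by abel
      rw [e, inner_add_left] at h1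
      linarith
    · filter_upwards [Ioc_mem_nhdsGT (zero_lt_one' ℝ)] with θ hθ
      have := (convex_closedBall x₀ r).add_smul_sub_mem hx (Metric.mem_closedBall_self hr.le)
        (t := θ) ⟨hθ.1.le, hθ.2⟩
      exact this

end Gradient

/-! ### The averaged forward map -/

section Average

variable {n : ℕ}

lemma isOpen_posOrthant : IsOpen (posOrthant n) := by
  have : posOrthant n = ⋂ i, {l : EuclideanSpace ℝ (Fin n) | 0 < l i} := by
    ext l; simp [posOrthant]
  rw [this]
  exact isOpen_iInter_of_finite fun i => isOpen_lt continuous_const (by fun_prop)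

lemma isPathConnected_posOrthant : IsPathConnected (posOrthant n) := by
  refine Convex.isPathConnected ?_ ⟨WithLp.toLp 2 fun _ => 1, fun i => one_pos⟩
  intro x hx y hy a b ha hb hab i
  have h1 := hx i
  have h2 := hy i
  simp only [PiLp.add_apply, PiLp.smul_apply, smul_eq_mul]
  rcases ha.eq_or_lt with h | h
  · have : b = 1 := by linarith
    subst h this
    simpa using h2
  · have := mul_pos h h1
    have := mul_nonneg hb h2.le
    linarith

lemma norm_le_sum_abs (x : EuclideanSpace ℝ (Fin n)) : ‖x‖ ≤ ∑ i, |x i| := by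
  rw [EuclideanSpace.norm_eq]
  refine Real.sqrt_le_iff.2 ⟨Finset.sum_nonneg fun i _ => abs_nonneg _, ?_⟩
  exact Finset.sum_sq_le_sq_sum_of_nonneg fun i _ => abs_nonneg _

variable {H : Type*} [NormedAddCommGroup H] [InnerProductSpace ℝ H]

lemma combOn_ne_zero {A : Fin n → H →ₗ.[ℝ] H} {u : commonDomain A} (hu : Admissible A u) {δ : EuclideanSpace ℝ (Fin n)}
    (hδ : δ ≠ 0) : combOn A δ u ≠ 0 := by
  intro h
  rw [combOn_apply] at h
  refine hδ ?_
  ext i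
  exact Fintype.linearIndependent_iff.1 hu (fun i => δ i) h i

lemma integral_pos_of_ae_pos {ρ : Measure ℝ} (hρ0 : ρ ≠ 0) {f : ℝ → ℝ} (hf : Integrable f ρ)
    (hpos : ∀ᵐ t ∂ρ, 0 < f t) : 0 < ∫ t, f t ∂ρ := by
  rw [integral_pos_iff_support_of_nonneg_ae (hpos.mono fun _ h => h.le) hf, pos_iff_ne_zero]
  intro h
  have h1 : ∀ᵐ t ∂ρ, False := by
    filter_upwards [hpos, compl_mem_ae_iff.2 h] with t h1 h2
    exact h2 (ne_of_gt h1)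
  rw [eventually_false_iff_eq_bot, ae_eq_bot] at h1
  exact hρ0 h1

/-- The map `F_α`, as an average of energies with respect to a measure on the half line. -/
noncomputable def averageMap (A : Fin n → H →ₗ.[ℝ] H)
    (S : EuclideanSpace ℝ (Fin n) → ℝ → H →L[ℝ] H) (ρ : Measure ℝ) (u : commonDomain A)
    (l : EuclideanSpace ℝ (Fin n)) : EuclideanSpace ℝ (Fin n) :=
  WithLp.toLp 2 fun i => ∫ t, inner ℝ (onCommon A i u) (S l (2 * t) u) ∂ρ

namespace IsSemigroupFamily

variable [CompleteSpace H] {A : Fin n → H →ₗ.[ℝ] H} {R : EuclideanSpace ℝ (Fin n) → H →L[ℝ] H}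
  {S : EuclideanSpace ℝ (Fin n) → ℝ → H →L[ℝ] H} (hF : IsSemigroupFamily A R S)
  {ρ : Measure ℝ} [IsFiniteMeasure ρ] (u : commonDomain A)
  {l m : EuclideanSpace ℝ (Fin n)}
include hF

lemma continuous_inner_semigroup (hl : l ∈ posOrthant n) (w : H) :
    Continuous fun t => inner ℝ w (S l (2 * t) u) :=
  continuous_const.inner (((hF.semigroup l hl).continuous (u : H)).comp
    (continuous_const.mul continuous_id))

lemma abs_inner_semigroup_le (hl : l ∈ posOrthant n) (w : H) (t : ℝ) :
    |inner ℝ w (S l t u)| ≤ ‖w‖ * ‖(u : H)‖ :=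
  (abs_real_inner_le_norm _ _).trans (by gcongr; exact (hF.semigroup l hl).norm_le t _)

lemma integrable_inner_semigroup (hl : l ∈ posOrthant n) (w : H) :
    Integrable (fun t => inner ℝ w (S l (2 * t) u)) ρ :=
  Integrable.of_bound (hF.continuous_inner_semigroup u hl w).aestronglyMeasurable
    (‖w‖ * ‖(u : H)‖) (Eventually.of_forall fun _ => hF.abs_inner_semigroup_le u hl w _)

lemma inner_averageMap (hl : l ∈ posOrthant n) (δ : EuclideanSpace ℝ (Fin n)) :
    inner ℝ (averageMap A S ρ u l) δ = ∫ t, inner ℝ (combOn A δ u) (S l (2 * t) u) ∂ρ := by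
  simp_rw [PiLp.inner_apply, combOn_apply, sum_inner, real_inner_smul_left]
  rw [integral_finsetSum _ fun i _ => (hF.integrable_inner_semigroup u hl _).const_mul _]
  refine Finset.sum_congr rfl fun i _ => ?_
  rw [integral_const_mul]
  simp [averageMap]

lemma continuousOn_semigroup (t : ℝ) (ht : 0 ≤ t) :
    ContinuousOn (fun l => S l t u) (posOrthant n) := by
  intro l hl
  rw [ContinuousWithinAt, tendsto_iff_norm_sub_tendsto_zero]
  have hc : Continuous fun m : EuclideanSpace ℝ (Fin n) => t * ‖combOn A (m - l) u‖ := by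
    simp_rw [combOn_apply]
    fun_prop
  have h0 : Tendsto (fun m : EuclideanSpace ℝ (Fin n) => t * ‖combOn A (m - l) u‖)
      (𝓝[posOrthant n] l) (𝓝 0) := by
    have := (hc.tendsto l).mono_left (nhdsWithin_le_nhds (s := posOrthant n))
    simpa [combOn] using this
  refine squeeze_zero' (Eventually.of_forall fun _ => norm_nonneg _) ?_ h0
  filter_upwards [self_mem_nhdsWithin] with m hm
  exact hF.norm_semigroup_sub_le hl hm ht u

lemma continuousOn_averageMap (hρ : ∀ᵐ t ∂ρ, 0 < t) :
    ContinuousOn (averageMap A S ρ u) (posOrthant n) := by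
  refine (PiLp.continuous_toLp 2 _).comp_continuousOn (continuousOn_pi.2 fun i => ?_)
  refine continuousOn_of_dominated (bound := fun _ => ‖onCommon A i u‖ * ‖(u : H)‖)
    (fun l hl => (hF.continuous_inner_semigroup u hl _).aestronglyMeasurable)
    (fun l hl => Eventually.of_forall fun _ => hF.abs_inner_semigroup_le u hl _ _)
    (integrable_const _) ?_
  filter_upwards [hρ] with t ht
  exact continuousOn_const.inner (hF.continuousOn_semigroup u _ (by positivity))

lemma averageMap_pos (hA : ∀ i, StrictlyPositive (A i)) (hu : Admissible A u)
    (hρ : ∀ᵐ t ∂ρ, 0 < t) (hρ0 : ρ ≠ 0) (hl : l ∈ posOrthant n) :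
    averageMap A S ρ u l ∈ posOrthant n := by
  intro i
  refine integral_pos_of_ae_pos hρ0 (hF.integrable_inner_semigroup u hl _) ?_
  filter_upwards [hρ] with t ht
  have hS := hF.semigroup l hl
  rw [two_mul, hS.map_add t t ht.le ht.le, mul_apply_eq_comp, ← hS.symm,
    ← hF.onCommon_semigroup hl]
  obtain ⟨Λ, hΛ, hc⟩ := hA i
  have h1 := hc (Submodule.inclusion (iInf_le (fun j => (A j).domain) i)
    ⟨S l t u, hF.semigroup_mem hl t u⟩)
  refine lt_of_lt_of_le (mul_pos hΛ (pow_pos (norm_pos_iff.2 fun h => ?_) 2)) h1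
  have h2 : (u : H) = 0 := hS.eq_zero_of_apply_eq_zero ht.le h
  have h3 : u = 0 := Subtype.ext h2
  refine (LinearIndependent.ne_zero i hu) ?_
  rw [h3, map_zero]

lemma norm_averageMap_le (hρ1 : ρ univ ≤ 1) (hl : l ∈ posOrthant n) :
    ‖averageMap A S ρ u l‖ ≤ normD A u * ‖(u : H)‖ := by
  refine (norm_le_sum_abs _).trans ?_
  rw [normD, Finset.sum_mul]
  refine Finset.sum_le_sum fun i _ => ?_
  have h := norm_integral_le_of_norm_le_const (μ := ρ)
    (f := fun t => inner ℝ (onCommon A i u) (S l (2 * t) u)) (C := ‖onCommon A i u‖ * ‖(u : H)‖)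
    (Eventually.of_forall fun _ => hF.abs_inner_semigroup_le u hl _ _)
  refine h.trans (mul_le_of_le_one_right (by positivity) ?_)
  exact ENNReal.toReal_le_of_le_ofReal zero_le_one (by simpa using hρ1)

lemma averageMap_strictAnti (hu : Admissible A u) (hρ : ∀ᵐ t ∂ρ, 0 < t) (hρ0 : ρ ≠ 0)
    (hl : l ∈ posOrthant n) (hm : m ∈ posOrthant n) (hlm : l ≠ m) :
    0 < inner ℝ (averageMap A S ρ u l - averageMap A S ρ u m) (m - l) := by
  rw [inner_sub_left, hF.inner_averageMap u hl, hF.inner_averageMap u hm,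
    ← integral_sub (hF.integrable_inner_semigroup u hl _) (hF.integrable_inner_semigroup u hm _)]
  refine integral_pos_of_ae_pos hρ0 ((hF.integrable_inner_semigroup u hl _).sub
    (hF.integrable_inner_semigroup u hm _)) ?_
  filter_upwards [hρ] with t ht
  have h2t : 0 < 2 * t := by positivity
  have h := (hF.inner_combOn_le hl hm h2t.le le_rfl u).2 h2t
    (combOn_ne_zero hu (sub_ne_zero.2 hlm.symm))
  rw [sub_self, (hF.semigroup l hl).map_zero, one_apply_eq_self] at h
  exact sub_pos.2 h

/-- Convexity at time 2t, divided by 2t and integrated. Subtracting ‖u‖² leaves differences of the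
potential unchanged and makes each integrand bounded. -/
lemma averageMap_subgradient (hρ : ∀ᵐ t ∂ρ, 0 < t) (hl : l ∈ posOrthant n)
    (hm : m ∈ posOrthant n) :
    inner ℝ (-averageMap A S ρ u l) (m - l)
      ≤ (∫ t, (inner ℝ (u : H) (S m (2 * t) u) - ‖(u : H)‖ ^ 2) / (2 * t) ∂ρ)
        - ∫ t, (inner ℝ (u : H) (S l (2 * t) u) - ‖(u : H)‖ ^ 2) / (2 * t) ∂ρ := by
  have hint : ∀ k ∈ posOrthant n, Integrable
      (fun t => (inner ℝ (u : H) (S k (2 * t) u) - ‖(u : H)‖ ^ 2) / (2 * t)) ρ := by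
    intro k hk
    refine Integrable.of_bound (C := ‖(u : H)‖ * ‖combOn A k u‖) ?_ ?_
    · exact (((hF.continuous_inner_semigroup u hk _).measurable.sub_const _).div
        (measurable_id.const_mul 2)).aestronglyMeasurable
    · filter_upwards [hρ] with t ht
      have h2t : 0 < 2 * t := by positivity
      rw [Real.norm_eq_abs, abs_div, abs_of_pos h2t, div_le_iff₀ h2t, mul_comm _ (2 * t)]
      exact hF.abs_inner_semigroup_sub_le hk h2t.le u
  rw [inner_neg_left, hF.inner_averageMap u hl, ← integral_neg,
    ← integral_sub (hint m hm) (hint l hl)]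
  refine integral_mono_ae (hF.integrable_inner_semigroup u hl _).neg
    ((hint m hm).sub (hint l hl)) ?_
  filter_upwards [hρ] with t ht
  have h2t : 0 < 2 * t := by positivity
  have h := hF.inner_semigroup_sub_ge hl hm h2t.le u
  rw [← sub_div, sub_sub_sub_cancel_right, le_div_iff₀ h2t]
  linarith

lemma isOpen_image_averageMap (hu : Admissible A u) (hρ : ∀ᵐ t ∂ρ, 0 < t) (hρ0 : ρ ≠ 0) :
    IsOpen (averageMap A S ρ u '' posOrthant n) := by
  have h := isOpen_image_of_strictMono_gradient isOpen_posOrthant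
    (G := fun l => -averageMap A S ρ u l) (hF.continuousOn_averageMap u hρ).neg
    (fun l hl m hm hlm => by
      rw [neg_sub_neg]; exact hF.averageMap_strictAnti u hu hρ hρ0 hl hm hlm)
    (fun l hl m hm => hF.averageMap_subgradient u hρ hl hm)
  rw [← image_image (fun y => -y), image_neg_eq_neg] at h
  simpa using h.neg

end IsSemigroupFamily

end Average

/-! ### The measure attached to the map `F_α` -/

section Main

/-- The distribution of `(τ + σ) / 2 * T ^ α` for `τ` and `σ` with density `Φ_α`. -/
noncomputable def timeMeasure (T α : ℝ) : Measure ℝ :=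
  ((wrightMeasure α).prod (wrightMeasure α)).map fun p => (p.1 + p.2) / 2 * T ^ α

lemma measurable_time (T α : ℝ) : Measurable fun p : ℝ × ℝ => (p.1 + p.2) / 2 * T ^ α := by
  fun_prop

lemma isFiniteMeasure_wrightMeasure {α : ℝ} (hα : 0 < α) (hα1 : α < 1) :
    IsFiniteMeasure (wrightMeasure α) :=
  ⟨(wrightMeasure_univ_le_one hα hα1).trans_lt ENNReal.one_lt_top⟩

lemma timeMeasure_univ (T : ℝ) {α : ℝ} (hα : 0 < α) (hα1 : α < 1) :
    timeMeasure T α univ = wrightMeasure α univ * wrightMeasure α univ := by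
  have := isFiniteMeasure_wrightMeasure hα hα1
  rw [timeMeasure, Measure.map_apply (measurable_time T α) MeasurableSet.univ, preimage_univ,
    ← univ_prod_univ, Measure.prod_prod]

lemma ae_timeMeasure_pos {T : ℝ} (hT : 0 < T) {α : ℝ} (hα : 0 < α) (hα1 : α < 1) :
    ∀ᵐ t ∂(timeMeasure T α), 0 < t := by
  have := isFiniteMeasure_wrightMeasure hα hα1
  rw [timeMeasure, ae_map_iff (measurable_time T α).aemeasurable measurableSet_Ioi]
  have h1 : ∀ᵐ p ∂(wrightMeasure α).prod (wrightMeasure α), 0 < p.1 :=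
    Measure.quasiMeasurePreserving_fst.ae (ae_wrightMeasure_pos α)
  have h2 : ∀ᵐ p ∂(wrightMeasure α).prod (wrightMeasure α), 0 < p.2 :=
    Measure.quasiMeasurePreserving_snd.ae (ae_wrightMeasure_pos α)
  filter_upwards [h1, h2] with p h1 h2
  have := Real.rpow_pos_of_pos hT α
  positivity

variable {H : Type*} [NormedAddCommGroup H] [InnerProductSpace ℝ H] [CompleteSpace H] {n : ℕ}
  {A : Fin n → H →ₗ.[ℝ] H} {R : EuclideanSpace ℝ (Fin n) → H →L[ℝ] H}
  {S : EuclideanSpace ℝ (Fin n) → ℝ → H →L[ℝ] H}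

/-- Change of variables and Fubini; the integrand is bounded and the product measure finite. -/
lemma IsSemigroupFamily.forwardMap_eq_timeMeasure (hF : IsSemigroupFamily A R S)
    (u : commonDomain A) {T : ℝ} (hT : 0 < T) {α : ℝ} (hα : 0 < α) (hα1 : α < 1)
    {l : EuclideanSpace ℝ (Fin n)} (hl : l ∈ posOrthant n) :
    forwardMap A (u : H) T α l = averageMap A S (timeMeasure T α) u l := by
  have := isFiniteMeasure_wrightMeasure hα hα1
  rw [forwardMap, averageMap]
  congr 1
  funext i
  set g : ℝ → ℝ := fun t => inner ℝ (onCommon A i u) (S l (2 * t) u) with hg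
  have hgc : Continuous g := hF.continuous_inner_semigroup u hl _
  rw [if_neg hα1.ne, timeMeasure, integral_map (measurable_time T α).aemeasurable
    hgc.aestronglyMeasurable, integral_prod]
  · rw [integral_wrightMeasure hα hα1]
    refine setIntegral_congr_fun measurableSet_Ioi fun τ hτ => ?_
    simp only
    rw [integral_wrightMeasure hα hα1, ← integral_const_mul]
    refine setIntegral_congr_fun measurableSet_Ioi fun σ hσ => ?_
    have hτ' : (0 : ℝ) < τ := hτ
    have hσ' : (0 : ℝ) < σ := hσ
    have := Real.rpow_pos_of_pos hT α
    rw [hF.energy_eq hl i (by positivity), mul_assoc]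
  · exact Integrable.of_bound (hgc.measurable.comp (measurable_time T α)).aestronglyMeasurable
      (‖onCommon A i u‖ * ‖(u : H)‖)
      (Eventually.of_forall fun p => hF.abs_inner_semigroup_le u hl _ _)

/-- The map `F_α` is an average of energies over positive times. -/
lemma IsSemigroupFamily.exists_measure (hF : IsSemigroupFamily A R S)
    (u : commonDomain A) {T : ℝ} (hT : 0 < T) {α : ℝ} (hα : 0 < α) (hα1 : α ≤ 1) :
    ∃ ρ : Measure ℝ, ρ univ ≤ 1 ∧ ρ ≠ 0 ∧ (∀ᵐ t ∂ρ, 0 < t) ∧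
      ∀ l ∈ posOrthant n, forwardMap A (u : H) T α l = averageMap A S ρ u l := by
  rcases hα1.eq_or_lt with rfl | hα1
  · refine ⟨Measure.dirac T, by simp, NeZero.ne _, ?_, fun l hl => ?_⟩
    · rw [ae_dirac_iff measurableSet_Ioi]
      exact hT
    · rw [forwardMap, averageMap]
      congr 1
      funext i
      rw [if_pos rfl, integral_dirac, hF.energy_eq hl i hT.le]
  · refine ⟨timeMeasure T α, ?_, ?_, ae_timeMeasure_pos hT hα hα1,
      fun l hl => hF.forwardMap_eq_timeMeasure u hT hα hα1 hl⟩
    · rw [timeMeasure_univ T hα hα1]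
      exact mul_le_one' (wrightMeasure_univ_le_one hα hα1) (wrightMeasure_univ_le_one hα hα1)
    · intro h
      have h1 := timeMeasure_univ T hα hα1
      rw [h, Measure.coe_zero, Pi.zero_apply, eq_comm, mul_self_eq_zero,
        Measure.measure_univ_eq_zero] at h1
      exact wrightMeasure_ne_zero hα hα1 h1

end Main

end FractionalInverse

theorem mainTheorem4 {H : Type*} [NormedAddCommGroup H] [InnerProductSpace ℝ H] [CompleteSpace H]
    [TopologicalSpace.SeparableSpace H] {n : ℕ} (A : Fin n → H →ₗ.[ℝ] H)
    (hA_selfAdjoint : ∀ i, IsSelfAdjoint (A i))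
    (hA_pos : ∀ i, FractionalInverse.StrictlyPositive (A i))
    (hA_comm : FractionalInverse.CommuteOnCommon A)
    (hA_comb : ∀ l ∈ FractionalInverse.posOrthant n,
      IsSelfAdjoint (FractionalInverse.combination A l))
    (T : ℝ) (hT : 0 < T)
    (u₀ : FractionalInverse.commonDomain A) (hu₀ : FractionalInverse.Admissible A u₀)
    (α : ℝ) (hα_pos : 0 < α) (hα_le : α ≤ 1) :
    FractionalInverse.imForward A (u₀ : H) T α ⊆ FractionalInverse.posOrthant n ∧
    IsOpen (FractionalInverse.imForward A (u₀ : H) T α) ∧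
    IsPathConnected (FractionalInverse.imForward A (u₀ : H) T α) ∧
    ∀ φ ∈ FractionalInverse.imForward A (u₀ : H) T α,
      ‖φ‖ ≤ FractionalInverse.normD A u₀ * ‖(u₀ : H)‖ := by
  open FractionalInverse in
  -- For n = 0 the empty combination is the zero operator, which need not be coercive, but ℝ^0 is a
  -- point.
  rcases Nat.eq_zero_or_pos n with rfl | hn
  · have hne : (imForward A (u₀ : H) T α).Nonempty := ⟨_, 0, fun i => i.elim0, rfl⟩
    refine ⟨fun φ _ i => i.elim0, isOpen_discrete _, ?_, fun φ _ => ?_⟩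
    · obtain ⟨φ, hφ⟩ := hne
      rw [Subsingleton.eq_univ_of_nonempty ⟨φ, hφ⟩]
      exact isPathConnected_univ
    · rw [Subsingleton.elim φ 0, norm_zero]
      exact mul_nonneg (Finset.sum_nonneg fun i _ => norm_nonneg _) (norm_nonneg _)
  · obtain ⟨R, S, hF⟩ :=
      exists_isSemigroupFamily hA_selfAdjoint hA_pos hA_comm hA_comb ⟨0, hn⟩
    obtain ⟨ρ, hρ1, hρ0, hρ, hF_eq⟩ := hF.exists_measure u₀ hT hα_pos hα_le
    have : IsFiniteMeasure ρ := ⟨hρ1.trans_lt ENNReal.one_lt_top⟩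
    have him : imForward A (u₀ : H) T α = averageMap A S ρ u₀ '' posOrthant n :=
      image_congr hF_eq
    rw [him]
    refine ⟨?_, hF.isOpen_image_averageMap u₀ hu₀ hρ hρ0,
      isPathConnected_posOrthant.image' (hF.continuousOn_averageMap u₀ hρ), ?_⟩
    · rintro _ ⟨l, hl, rfl⟩
      exact hF.averageMap_pos u₀ hA_pos hu₀ hρ hρ0 hl
    · rintro _ ⟨l, hl, rfl⟩
      exact hF.norm_averageMap_le u₀ hρ1 hl
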